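/- **Theorem 3.1 (Semiclassical Moser–Trudinger inequality for all $d$).** Let $d\ge 1$, $s=d/2$, and let $\Omega\subset\mathbb R^d$ be an open bounded set. Extend functions on $\Omega$ by zero to $\mathbb R^d$, write $\hat u(\xi)=\int_{\mathbb R^d}u(x)e^{-2\pi i\xi\cdot x}\,dx$ for the Fourier transform of the extension (understood on $L^2(\mathbb R^d)$), and put $\|u\|_{H_0^s(\Omega)}^2=\int_{\mathbb R^d}|2\pi\xi|^{2s}|\hat u(\xi)|^2\,d\xi$. Let $H_0^s(\Omega)$ be the closure of $C_c^\infty(\Omega)$ in this norm or, alternatively, the space of all complex-valued $u\in L^2(\Omega)$ whose extension by zero lies in $H^s(\mathbb R^d)$ (the statement holds for either choice). Let $(-\Delta_\Omega)^s$ be the self-adjoint operator on $L^2(\Omega)$ associated with the quadratic form $\|u\|_{H_0^s(\Omega)}^2$ with form domain $H_0^s(\Omega)$, and let $(-\Delta_\Omega)^{-s}$ be its (bounded) inverse. Let $\omega_d$ be the volume of the unit ball of $\mathbb R^d$. Let $u_1,\dots,u_N\in H_0^s(\Omega)$ satisfy $$\sum_{n=1}^N|u_n\rangle\langle u_n|\le(-\Delta_\Omega)^{-s}\quad\text{on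 }L^2(\Omega),$$ and define $\rho(x)=\sum_{n=1}^N|u_n(x)|^2$. Then: (i) for all $N\ge1$ and all $\epsilon\in(0,1/4]$, $$\frac1{|\Omega|}\int_\Omega\exp\Big(\frac{(2\pi)^d}{\omega_d}(1-\epsilon)\rho(x)\Big)\,dx\le\frac{22}{\epsilon^4}\,N\exp\Big(\frac{(2\pi)^d}{\omega_d}\Big);$$ (ii) for all $\alpha>0$, if $N\ge\max\big\{e^4,\exp\big(\frac{\alpha\omega_d}{(2\pi)^d}+1\big)\big\}$, then $$\frac1{|\Omega|}\int_\Omega\exp\Big(\alpha\frac{\rho(x)}{\ln N}\Big)\,dx\le\exp\Big(\frac{\alpha\omega_d}{(2\pi)^d}\Big[1+\frac{4(2\pi)^d}{\omega_d}\cdot\frac{\ln\ln N}{\ln N}\Big]\Big).$$ -/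

import Mathlib

open MeasureTheory TopologicalSpace FourierTransform
open scoped ENNReal ContDiff InnerProductSpace

noncomputable section

/-- The Euclidean space `ℝ^d`. -/
abbrev RSpace (d : ℕ) : Type := EuclideanSpace ℝ (Fin d)

/-- The complex Hilbert space `L²(Ω)`. -/
abbrev L2 {d : ℕ} (Ω : Opens (RSpace d)) : Type :=
  Lp ℂ 2 ((volume : Measure (RSpace d)).restrict (Ω : Set (RSpace d)))

/-- The volume `ω_d` of the unit ball of `ℝ^d`. -/
def unitBallVolume (d : ℕ) : ℝ :=
  (volume (Metric.ball (0 : RSpace d) 1)).toReal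

lemma memLp_extend {d : ℕ} (Ω : Opens (RSpace d)) (u : L2 Ω) :
    MemLp ((Ω : Set (RSpace d)).indicator u) 2 (volume : Measure (RSpace d)) :=
  (memLp_indicator_iff_restrict Ω.isOpen.measurableSet).2 (Lp.memLp u)

/-- The extension by zero `L²(Ω) → L²(ℝ^d)`. -/
def extendByZero {d : ℕ} (Ω : Opens (RSpace d)) :
    L2 Ω →ₗᵢ[ℂ] Lp ℂ 2 (volume : Measure (RSpace d)) where
  toFun u := (memLp_extend Ω u).toLp _
  map_add' u v := by
    rw [← MemLp.toLp_add, MemLp.toLp_eq_toLp_iff, ← Set.indicator_add']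
    exact (ae_eq_restrict_iff_indicator_ae_eq Ω.isOpen.measurableSet).1 (Lp.coeFn_add u v)
  map_smul' c u := by
    rw [RingHom.id_apply, ← MemLp.toLp_const_smul, MemLp.toLp_eq_toLp_iff]
    refine ((ae_eq_restrict_iff_indicator_ae_eq Ω.isOpen.measurableSet).1
      (Lp.coeFn_smul c u)).trans (Filter.Eventually.of_forall fun x => ?_)
    simp [Set.indicator]
  norm_map' u := by
    simp [Lp.norm_def, eLpNorm_congr_ae (MemLp.coeFn_toLp _),
      eLpNorm_indicator_eq_eLpNorm_restrict Ω.isOpen.measurableSet]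

/-- The function `ξ ↦ |2πξ|^s û(ξ)`, where `û` is the Fourier transform on `L²(ℝ^d)` (with the
convention `û(ξ) = ∫ u(x) e^{-2πi ξ·x} dx`) of the extension of `u` by zero. -/
def fracSymbol {d : ℕ} (s : ℝ) {Ω : Opens (RSpace d)} (u : L2 Ω) : RSpace d → ℂ :=
  fun ξ => ((‖(2 * Real.pi) • ξ‖ ^ s : ℝ) : ℂ) * (𝓕 (extendByZero Ω u)) ξ

lemma fracSymbol_add {d : ℕ} (s : ℝ) {Ω : Opens (RSpace d)} (u v : L2 Ω) :
    fracSymbol s (u + v) =ᵐ[volume] fracSymbol s u + fracSymbol s v := by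
  have h : 𝓕 (extendByZero Ω (u + v)) = 𝓕 (extendByZero Ω u) + 𝓕 (extendByZero Ω v) := by
    rw [map_add, FourierAdd.fourier_add]
  filter_upwards [Lp.coeFn_add (𝓕 (extendByZero Ω u)) (𝓕 (extendByZero Ω v))] with ξ hξ
  simp only [fracSymbol, h, hξ, Pi.add_apply, mul_add]

lemma fracSymbol_smul {d : ℕ} (s : ℝ) {Ω : Opens (RSpace d)} (c : ℂ) (u : L2 Ω) :
    fracSymbol s (c • u) =ᵐ[volume] c • fracSymbol s u := by
  have h : 𝓕 (extendByZero Ω (c • u)) = c • 𝓕 (extendByZero Ω u) := by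
    rw [map_smul, FourierSMul.fourier_smul]
  filter_upwards [Lp.coeFn_smul c (𝓕 (extendByZero Ω u))] with ξ hξ
  simp only [fracSymbol, h, hξ, Pi.smul_apply, smul_eq_mul]
  ring

/-- The space of all `u ∈ L²(Ω)` whose extension by zero belongs to `H^s(ℝ^d)` (for `s ≥ 0`). -/
def extSobolev {d : ℕ} (s : ℝ) (Ω : Opens (RSpace d)) : Submodule ℂ (L2 Ω) where
  carrier := {u | MemLp (fracSymbol s u) 2 volume}
  add_mem' {u v} hu hv := (memLp_congr_ae (fracSymbol_add s u v)).2 (hu.add hv)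
  zero_mem' := by
    have h := fracSymbol_smul s (Ω := Ω) 0 0
    rw [zero_smul, zero_smul] at h
    exact (memLp_congr_ae h).2 MemLp.zero
  smul_mem' c u hu := (memLp_congr_ae (fracSymbol_smul s c u)).2 (hu.const_smul c)

lemma memLp_fracSymbol {d : ℕ} {s : ℝ} {Ω : Opens (RSpace d)} (u : extSobolev s Ω) :
    MemLp (fracSymbol s (u : L2 Ω)) 2 volume := u.2

/-- The map `u ↦ |2πξ|^s û(ξ)` into `L²(ℝ^d)`. The squared norm of its value at `u` is
`‖u‖²_{H_0^s(Ω)} = ∫ |2πξ|^{2s} |û(ξ)|² dξ`, and the inner product of its values is the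
corresponding sesquilinear form. -/
def energyMap {d : ℕ} (s : ℝ) (Ω : Opens (RSpace d)) :
    extSobolev s Ω →ₗ[ℂ] Lp ℂ 2 (volume : Measure (RSpace d)) where
  toFun u := MemLp.toLp (fracSymbol s (u : L2 Ω)) (memLp_fracSymbol u)
  map_add' u v :=
    (MemLp.toLp_congr _ (((memLp_fracSymbol u).add (memLp_fracSymbol v)))
      (fracSymbol_add s (u : L2 Ω) v)).trans (MemLp.toLp_add _ _)
  map_smul' c u :=
    (MemLp.toLp_congr _ ((memLp_fracSymbol u).const_smul c)
      (fracSymbol_smul s c (u : L2 Ω))).trans (MemLp.toLp_const_smul c _)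

/-- The space `C_c^∞(Ω)` of complex-valued test functions. -/
def testFunctions {d : ℕ} (s : ℝ) (Ω : Opens (RSpace d)) : Submodule ℂ (extSobolev s Ω) where
  carrier := {u | ∃ φ : RSpace d → ℂ, ContDiff ℝ ∞ φ ∧ HasCompactSupport φ ∧
    tsupport φ ⊆ (Ω : Set (RSpace d)) ∧
    ((u : L2 Ω) : RSpace d → ℂ) =ᵐ[volume.restrict (Ω : Set (RSpace d))] φ}
  add_mem' := by
    rintro u v ⟨φ, h1, h2, h3, h4⟩ ⟨ψ, k1, k2, k3, k4⟩
    refine ⟨φ + ψ, h1.add k1, h2.add k2,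
      (tsupport_add φ ψ).trans (Set.union_subset h3 k3), ?_⟩
    exact (Lp.coeFn_add (u : L2 Ω) (v : L2 Ω)).trans (h4.add k4)
  zero_mem' := ⟨0, contDiff_const, HasCompactSupport.zero, by simp,
    Lp.coeFn_zero _ _ _⟩
  smul_mem' := by
    rintro c u ⟨φ, h1, h2, h3, h4⟩
    refine ⟨c • φ, contDiff_const.smul h1, h2.smul_left (f := fun _ => c),
      (closure_mono (Function.support_const_smul_subset c φ)).trans h3, ?_⟩
    exact (Lp.coeFn_smul c (u : L2 Ω)).trans (h4.const_smul c)

/-- The closure of `C_c^∞(Ω)` in the norm `‖·‖_{H_0^s(Ω)}`. -/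
def zeroSobolev {d : ℕ} (s : ℝ) (Ω : Opens (RSpace d)) : Submodule ℂ (extSobolev s Ω) :=
  (((testFunctions s Ω).map (energyMap s Ω)).topologicalClosure).comap (energyMap s Ω)

/-- The graph of the operator `(-Δ_Ω)^s` on `L²(Ω)` associated with the quadratic form
`u ↦ ∫ |2πξ|^{2s} |û(ξ)|² dξ` with form domain `Q`: the pair `(w, f)` is in the graph if `w ∈ Q` and
`a(v, w) = ⟨v, f⟩` for all `v ∈ Q`, where `a` is the sesquilinear form. -/
def fracLaplacianGraph {d : ℕ} (s : ℝ) (Ω : Opens (RSpace d))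
    (Q : Submodule ℂ (extSobolev s Ω)) : Set (L2 Ω × L2 Ω) :=
  {p | ∃ w ∈ Q, (w : L2 Ω) = p.1 ∧
    ∀ v ∈ Q, ⟪energyMap s Ω v, energyMap s Ω w⟫_ℂ = ⟪(v : L2 Ω), p.2⟫_ℂ}

/-- The bounded operator `T` is the inverse of `(-Δ_Ω)^s`. -/
def IsFracLaplacianInv {d : ℕ} (s : ℝ) (Ω : Opens (RSpace d))
    (Q : Submodule ℂ (extSobolev s Ω)) (T : L2 Ω →L[ℂ] L2 Ω) : Prop :=
  ∀ f w : L2 Ω, T f = w ↔ (w, f) ∈ fracLaplacianGraph s Ω Q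

open Classical in
/-- The bounded operator `(-Δ_Ω)^{-s}` on `L²(Ω)`. It exists, and is unique, when `s > 0`, `d ≥ 1`,
`Ω` is bounded and the form domain is closed in the form norm: this is
`isFracLaplacianInv_fracLaplacianInv` together with `isClosed_map_energyMap`. -/
def fracLaplacianInv {d : ℕ} (s : ℝ) (Ω : Opens (RSpace d))
    (Q : Submodule ℂ (extSobolev s Ω)) : L2 Ω →L[ℂ] L2 Ω :=
  if h : ∃ T : L2 Ω →L[ℂ] L2 Ω, IsFracLaplacianInv s Ω Q T then h.choose else 0

lemma fourier_ae_eq_integral {d : ℕ} (U : Lp ℂ 2 (volume : Measure (RSpace d)))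
    (hU : Integrable U volume) :
    ((𝓕 U : Lp ℂ 2 (volume : Measure (RSpace d))) : RSpace d → ℂ) =ᵐ[volume]
      𝓕 (U : RSpace d → ℂ) := by
  have hc : Continuous (𝓕 (U : RSpace d → ℂ)) :=
    VectorFourier.fourierIntegral_continuous Real.continuous_fourierChar
      (innerSL ℝ).continuous₂ hU
  refine ae_eq_of_integral_contDiff_smul_eq
    ((Lp.memLp _).locallyIntegrable (by norm_num)) hc.locallyIntegrable fun g hg hgc => ?_
  have hg₁ : HasCompactSupport (Complex.ofRealCLM ∘ g) := hgc.comp_left rfl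
  have hg₂ : ContDiff ℝ ∞ (Complex.ofRealCLM ∘ g) := by fun_prop
  set G : SchwartzMap (RSpace d) ℂ := hg₁.toSchwartzMap hg₂ with hG
  have e1 := congrArg (fun T => T G) (Lp.fourier_toTemperedDistribution_eq U)
  simp only [TemperedDistribution.fourier_apply, Lp.toTemperedDistribution_apply] at e1
  have e2 := VectorFourier.integral_fourierIntegral_smul_eq_flip (L := innerₗ (RSpace d))
    (f := (G : RSpace d → ℂ)) (g := (U : RSpace d → ℂ)) (μ := volume) (ν := volume)
    Real.continuous_fourierChar continuous_inner G.integrable hU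
  rw [flip_innerₗ] at e2
  have e3 : ∫ x, (G x) • (𝓕 U : Lp ℂ 2 (volume : Measure (RSpace d))) x
      = ∫ x, G x • 𝓕 (U : RSpace d → ℂ) x := by
    rw [← e1]
    exact e2
  simpa [hG] using e3

lemma norm_fourier_le {d : ℕ} (Ω : Opens (RSpace d))
    (hΩ : Bornology.IsBounded (Ω : Set (RSpace d))) :
    ∃ K : ℝ, 0 ≤ K ∧ ∀ u : L2 Ω, ∀ᵐ ξ, ‖(𝓕 (extendByZero Ω u)) ξ‖ ≤ K * ‖u‖ := by
  have hfin : IsFiniteMeasure ((volume : Measure (RSpace d)).restrict (Ω : Set (RSpace d))) :=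
    ⟨by simpa using hΩ.measure_lt_top⟩
  set μ := (volume : Measure (RSpace d)).restrict (Ω : Set (RSpace d)) with hμ
  refine ⟨(μ Set.univ ^ (1 / (1 : ℝ≥0∞).toReal - 1 / (2 : ℝ≥0∞).toReal)).toReal,
    ENNReal.toReal_nonneg, fun u => ?_⟩
  have hu1 : MemLp u 1 μ := (Lp.memLp u).mono_exponent (by norm_num)
  have hext : (extendByZero Ω u : RSpace d → ℂ) =ᵐ[volume]
      (Ω : Set (RSpace d)).indicator u := MemLp.coeFn_toLp (memLp_extend Ω u)
  have hint : Integrable (extendByZero Ω u : RSpace d → ℂ) volume := by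
    rw [integrable_congr hext, integrable_indicator_iff Ω.isOpen.measurableSet]
    exact memLp_one_iff_integrable.1 hu1
  have hbd : ∫ x, ‖(extendByZero Ω u) x‖ ≤
      (μ Set.univ ^ (1 / (1 : ℝ≥0∞).toReal - 1 / (2 : ℝ≥0∞).toReal)).toReal * ‖u‖ := by
    have h1 : ∫ x, ‖(extendByZero Ω u) x‖ = (eLpNorm u 1 μ).toReal := by
      rw [integral_norm_eq_lintegral_enorm hint.1, ← eLpNorm_one_eq_lintegral_enorm,
        eLpNorm_congr_ae hext, eLpNorm_indicator_eq_eLpNorm_restrict Ω.isOpen.measurableSet]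
    rw [h1, Lp.norm_def, mul_comm, ← ENNReal.toReal_mul]
    refine ENNReal.toReal_mono (ENNReal.mul_ne_top (Lp.memLp u).2.ne
      (ENNReal.rpow_ne_top_of_nonneg (by norm_num) (measure_ne_top _ _))) ?_
    exact eLpNorm_le_eLpNorm_mul_rpow_measure_univ (by norm_num) (Lp.memLp u).1
  filter_upwards [fourier_ae_eq_integral _ hint] with ξ hξ
  rw [hξ]
  exact (VectorFourier.norm_fourierIntegral_le_integral_norm _ _ _ _ _).trans hbd

lemma norm_sq_eq_lintegral {d : ℕ} (f : Lp ℂ 2 (volume : Measure (RSpace d))) :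
    ENNReal.ofReal (‖f‖ ^ 2) = ∫⁻ x, ENNReal.ofReal (‖f x‖ ^ 2) := by
  have h := @L2.inner_def (RSpace d) ℂ ℂ _ _ volume _ _ f f
  rw [inner_self_eq_norm_sq_to_K] at h
  have h2 : ‖f‖ ^ 2 = ∫ x, ‖f x‖ ^ 2 := by
    have h3 : ((‖f‖ ^ 2 : ℝ) : ℂ) = ((∫ x, ‖f x‖ ^ 2 : ℝ) : ℂ) := by
      rw [← integral_complex_ofReal]
      simpa [inner_self_eq_norm_sq_to_K] using h
    exact_mod_cast h3
  rw [h2, ofReal_integral_eq_lintegral_ofReal]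
  · exact (memLp_two_iff_integrable_sq_norm (Lp.memLp f).1).1 (Lp.memLp f)
  · exact Filter.Eventually.of_forall fun x => by positivity

/-- A Poincaré inequality. -/
lemma exists_norm_le_energyMap {d : ℕ} (hd : 1 ≤ d) {s : ℝ} (hs : 0 < s) (Ω : Opens (RSpace d))
    (hΩ : Bornology.IsBounded (Ω : Set (RSpace d))) :
    ∃ C : ℝ, 0 ≤ C ∧ ∀ w : extSobolev s Ω, ‖(w : L2 Ω)‖ ≤ C * ‖energyMap s Ω w‖ := by
  obtain ⟨K, hK, hKb⟩ := norm_fourier_le Ω hΩ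
  set b : ℝ := (volume (Metric.ball (0 : RSpace d) 1)).toReal with hb
  have hb0 : 0 ≤ b := ENNReal.toReal_nonneg
  set r : ℝ := 1 / (2 * (K ^ 2 * b + 1)) with hr
  have hpos : 0 < K ^ 2 * b + 1 := by positivity
  have hr0 : 0 < r := by positivity
  have hr1 : r ≤ 1 := by
    rw [hr, div_le_one (by positivity)]
    nlinarith [mul_nonneg (sq_nonneg K) hb0]
  have hvol : volume (Metric.ball (0 : RSpace d) r) ≤ ENNReal.ofReal (r * b) := by
    have : Nonempty (Fin d) := ⟨⟨0, hd⟩⟩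
    rw [Measure.addHaar_ball _ _ hr0.le, ENNReal.ofReal_mul hr0.le, hb,
      ENNReal.ofReal_toReal measure_ball_lt_top.ne]
    gcongr
    simpa using pow_le_of_le_one hr0.le hr1 (by omega)
  set a : ℝ := ((2 * Real.pi * r) ^ s)⁻¹ with ha
  have ha0 : 0 ≤ a := by positivity
  refine ⟨Real.sqrt 2 * a, by positivity, fun w => ?_⟩
  set F := 𝓕 (extendByZero Ω (w : L2 Ω)) with hF
  have hFn : ‖F‖ = ‖(w : L2 Ω)‖ := by
    rw [hF, Lp.norm_fourier_eq, LinearIsometry.norm_map]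
  set S := energyMap s Ω w with hS
  have hSae : (S : RSpace d → ℂ) =ᵐ[volume] fracSymbol s (w : L2 Ω) :=
    MemLp.coeFn_toLp (memLp_fracSymbol w)
  have hpt : ∀ᵐ ξ : RSpace d, ENNReal.ofReal (‖F ξ‖ ^ 2) ≤
      (Metric.ball (0 : RSpace d) r).indicator
        (fun _ => ENNReal.ofReal ((K * ‖(w : L2 Ω)‖) ^ 2)) ξ +
      ENNReal.ofReal (a ^ 2) * ENNReal.ofReal (‖S ξ‖ ^ 2) := by
    filter_upwards [hKb (w : L2 Ω), hSae] with ξ h1 h2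
    by_cases hξ : ξ ∈ Metric.ball (0 : RSpace d) r
    · rw [Set.indicator_of_mem hξ]
      refine le_add_right (ENNReal.ofReal_le_ofReal ?_)
      gcongr
    · rw [Set.indicator_of_notMem hξ, zero_add, ← ENNReal.ofReal_mul (by positivity), ← mul_pow]
      refine ENNReal.ofReal_le_ofReal ?_
      gcongr
      have hξr : r ≤ ‖ξ‖ := by simpa using hξ
      have h3 : (2 * Real.pi * r) ^ s ≤ ‖(2 * Real.pi) • ξ‖ ^ s := by
        rw [norm_smul, Real.norm_of_nonneg (by positivity)]
        gcongr
      have hp : 0 < (2 * Real.pi * r) ^ s := by positivity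
      rw [h2, fracSymbol, norm_mul, Complex.norm_real, Real.norm_of_nonneg (by positivity), ha,
        inv_mul_eq_div, le_div_iff₀ hp, mul_comm]
      exact mul_le_mul_of_nonneg_right h3 (norm_nonneg _)
  have hint := lintegral_mono_ae hpt
  rw [← norm_sq_eq_lintegral F, lintegral_add_left
    (measurable_const.indicator Metric.isOpen_ball.measurableSet),
    lintegral_indicator_const Metric.isOpen_ball.measurableSet,
    lintegral_const_mul' _ _ ENNReal.ofReal_ne_top, ← norm_sq_eq_lintegral S] at hint
  have h4 : ENNReal.ofReal (‖F‖ ^ 2) ≤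
      ENNReal.ofReal ((K * ‖(w : L2 Ω)‖) ^ 2 * (r * b) + a ^ 2 * ‖S‖ ^ 2) := by
    refine hint.trans ?_
    rw [ENNReal.ofReal_add (by positivity) (by positivity),
      ENNReal.ofReal_mul (p := (K * ‖(w : L2 Ω)‖) ^ 2) (by positivity),
      ENNReal.ofReal_mul (p := a ^ 2) (by positivity)]
    gcongr
  rw [ENNReal.ofReal_le_ofReal_iff (by positivity), hFn] at h4
  have h5 : K ^ 2 * (r * b) ≤ 1 / 2 := by
    rw [hr, show K ^ 2 * (1 / (2 * (K ^ 2 * b + 1)) * b) =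
      (K ^ 2 * b) / (2 * (K ^ 2 * b + 1)) by ring, div_le_iff₀ (by positivity)]
    linarith
  have h6 : ‖(w : L2 Ω)‖ ^ 2 ≤ (Real.sqrt 2 * a * ‖S‖) ^ 2 := by
    rw [mul_pow, mul_pow, Real.sq_sqrt (by norm_num)]
    nlinarith [mul_le_mul_of_nonneg_right h5 (sq_nonneg ‖(w : L2 Ω)‖)]
  exact (sq_le_sq₀ (by positivity) (by positivity)).1 h6

lemma isClosed_range_energyMap {d : ℕ} (hd : 1 ≤ d) {s : ℝ} (hs : 0 < s) (Ω : Opens (RSpace d))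
    (hΩ : Bornology.IsBounded (Ω : Set (RSpace d))) :
    IsClosed (Set.range (energyMap s Ω)) := by
  obtain ⟨C, hC, hP⟩ := exists_norm_le_energyMap hd hs Ω hΩ
  refine isClosed_of_closure_subset fun g hg => ?_
  obtain ⟨x, hx, hxg⟩ := mem_closure_iff_seq_limit.1 hg
  choose w hw using hx
  have hcau : CauchySeq (fun n => (w n : L2 Ω)) := by
    refine Metric.cauchySeq_iff.2 fun ε hε => ?_
    obtain ⟨N, hN⟩ := Metric.cauchySeq_iff.1 hxg.cauchySeq (ε / (C + 1)) (by positivity)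
    refine ⟨N, fun m hm n hn => ?_⟩
    have h1 := hP (w m - w n)
    have h2 := hN m hm n hn
    rw [map_sub, hw, hw, ← dist_eq_norm, AddSubgroupClass.coe_sub, ← dist_eq_norm] at h1
    have h3 : dist (x m) (x n) * (C + 1) < ε := (lt_div_iff₀ (by positivity)).1 h2
    nlinarith [dist_nonneg (x := x m) (y := x n)]
  obtain ⟨u, hu⟩ := cauchySeq_tendsto_of_complete hcau
  have hF : Filter.Tendsto (fun n => 𝓕 (extendByZero Ω (w n : L2 Ω))) Filter.atTop
      (nhds (𝓕 (extendByZero Ω u))) :=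
    ((Lp.fourierTransformₗᵢ (RSpace d) ℂ).continuous.tendsto _).comp
      (((extendByZero Ω).continuous.tendsto u).comp hu)
  obtain ⟨ns, hns, h1⟩ := (tendstoInMeasure_of_tendsto_Lp hF).exists_seq_tendsto_ae
  obtain ⟨ms, hms, h2⟩ :=
    (tendstoInMeasure_of_tendsto_Lp (hxg.comp hns.tendsto_atTop)).exists_seq_tendsto_ae
  have hall : ∀ᵐ ξ, ∀ n, (x n) ξ = fracSymbol s (w n : L2 Ω) ξ := by
    refine ae_all_iff.2 fun n => ?_
    rw [← hw n]
    exact MemLp.coeFn_toLp (memLp_fracSymbol (w n))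
  have hae : (g : RSpace d → ℂ) =ᵐ[volume] fracSymbol s u := by
    filter_upwards [h1, h2, hall] with ξ k1 k2 k3
    refine tendsto_nhds_unique k2 ?_
    simp only [Function.comp, k3, fracSymbol]
    exact (k1.comp hms.tendsto_atTop).const_mul _
  have hmem : MemLp (fracSymbol s u) 2 volume := (memLp_congr_ae hae).1 (Lp.memLp g)
  refine ⟨⟨u, hmem⟩, ?_⟩
  exact Lp.ext ((MemLp.coeFn_toLp hmem).trans hae.symm)

lemma energyMap_injective {d : ℕ} (hd : 1 ≤ d) {s : ℝ} (hs : 0 < s) (Ω : Opens (RSpace d))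
    (hΩ : Bornology.IsBounded (Ω : Set (RSpace d))) : Function.Injective (energyMap s Ω) := by
  obtain ⟨C, hC, hP⟩ := exists_norm_le_energyMap hd hs Ω hΩ
  refine (injective_iff_map_eq_zero _).2 fun w hw => ?_
  have h := hP w
  rw [hw, norm_zero, mul_zero] at h
  exact Subtype.ext (norm_le_zero_iff.1 h)

/-- The operator `(-Δ_Ω)^{-s}` exists for every closed form domain. -/
theorem isFracLaplacianInv_fracLaplacianInv {d : ℕ} (hd : 1 ≤ d) {s : ℝ} (hs : 0 < s)
    (Ω : Opens (RSpace d)) (hΩ : Bornology.IsBounded (Ω : Set (RSpace d)))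
    (Q : Submodule ℂ (extSobolev s Ω))
    (hQ : IsClosed (SetLike.coe (Q.map (energyMap s Ω)))) :
    IsFracLaplacianInv s Ω Q (fracLaplacianInv s Ω Q) := by
  suffices h : ∃ T : L2 Ω →L[ℂ] L2 Ω, IsFracLaplacianInv s Ω Q T by
    rw [fracLaplacianInv, dif_pos h]
    exact h.choose_spec
  obtain ⟨C, hC, hP⟩ := exists_norm_le_energyMap hd hs Ω hΩ
  have hinj := energyMap_injective hd hs Ω hΩ
  have : CompleteSpace (Q.map (energyMap s Ω)) := hQ.completeSpace_coe
  let e : Q ≃ₗ[ℂ] Q.map (energyMap s Ω) := Submodule.equivMapOfInjective _ hinj Q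
  have he : ∀ v : Q, ((e v : Q.map (energyMap s Ω)) : Lp ℂ 2 volume) = energyMap s Ω v :=
    fun v => rfl
  let J₀ : Q.map (energyMap s Ω) →ₗ[ℂ] L2 Ω :=
    (extSobolev s Ω).subtype ∘ₗ Q.subtype ∘ₗ e.symm.toLinearMap
  have hJ₀ : ∀ v : Q, J₀ (e v) = ((v : extSobolev s Ω) : L2 Ω) := fun v => by simp [J₀]
  let J : Q.map (energyMap s Ω) →L[ℂ] L2 Ω := J₀.mkContinuous C fun g => by
    obtain ⟨v, rfl⟩ := e.surjective g
    rw [hJ₀]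
    exact hP v
  have hJ : ∀ v : Q, J (e v) = ((v : extSobolev s Ω) : L2 Ω) := hJ₀
  let T : L2 Ω →L[ℂ] L2 Ω := J ∘L (ContinuousLinearMap.adjoint J)
  have hT : ∀ f, (T f, f) ∈ fracLaplacianGraph s Ω Q := fun f => by
    obtain ⟨w, hw⟩ := e.surjective (ContinuousLinearMap.adjoint J f)
    refine ⟨w, w.2, ?_, fun v hv => ?_⟩
    · simp only [T, ContinuousLinearMap.comp_apply]
      rw [← hw, hJ]
    · rw [← hJ ⟨v, hv⟩, ← ContinuousLinearMap.adjoint_inner_right, ← hw]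
      rfl
  refine ⟨T, fun f w => ⟨fun h => h ▸ hT f, ?_⟩⟩
  rintro ⟨w₁, hw₁, rfl, h₁⟩
  obtain ⟨w₂, hw₂, h₂', h₂⟩ := hT f
  simp only at h₁ h₂ h₂' ⊢
  rw [← h₂']
  congr 1
  apply hinj
  rw [← sub_eq_zero, ← map_sub, ← inner_self_eq_zero (𝕜 := ℂ)]
  have hm := Q.sub_mem hw₂ hw₁
  conv_lhs => arg 3; rw [map_sub]
  rw [inner_sub_right, h₁ _ hm, h₂ _ hm, sub_self]

/-- Both form domains in question are closed. -/
lemma isClosed_map_energyMap {d : ℕ} (hd : 1 ≤ d) {s : ℝ} (hs : 0 < s) (Ω : Opens (RSpace d))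
    (hΩ : Bornology.IsBounded (Ω : Set (RSpace d))) (Q : Submodule ℂ (extSobolev s Ω))
    (hQ : Q = zeroSobolev s Ω ∨ Q = ⊤) :
    IsClosed (SetLike.coe (Q.map (energyMap s Ω))) := by
  have hr := isClosed_range_energyMap hd hs Ω hΩ
  rcases hQ with rfl | rfl
  · rw [zeroSobolev, Submodule.map_comap_eq, Submodule.coe_inf]
    exact hr.inter (Submodule.isClosed_topologicalClosure _)
  · rw [Submodule.map_top]
    exact hr

/-- The one-body density `ρ = ∑ |u_n|²`. -/
def density {d : ℕ} {s : ℝ} {Ω : Opens (RSpace d)} {N : ℕ} (u : Fin N → extSobolev s Ω)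
    (x : RSpace d) : ℝ :=
  ∑ n, ‖((u n : L2 Ω) : RSpace d → ℂ) x‖ ^ 2

end

/-! Write c = (2π)^d/ω_d and V = |Ω|. By duality the operator inequality says that a ↦ ∑ a_n u_n is
a contraction from ℂ^N into the energy space (`norm_energyMap_sum_sq_le`).

Cut each u_n at a frequency radius r. At a fixed point x the contraction bounds the density of the
low parts by the integral of the inverse symbol over |ξ| < r, whatever N is. For the symbol |2πξ|^d
this integral would grow like (1/c) log (2πr)^d, the source of the sharp constant c, but it diverges
at ξ = 0. A Poincaré inequality with constant Λ = c/(4V) cures this: a fraction θ of the energy is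
traded for the constant θΛ in the symbol (`mixedWeight`, `sum_norm_lowFrequency_sq_le`,
`integral_ball_mixedWeight_inv`).

The number N enters through the high parts: each u_n has energy at most 1, so their total mass is at
most N/(2πr)^d (`lintegral_sub_lowFrequency_sq_le`). For a level y, take r so large that the low
parts just fail to reach it; Chebyshev's inequality for the high parts then shows that {cρ > y} has
measure of order N V e^{-(1-3ε/4)y}, up to powers of ε and y (`measure_lt_density_le`). Integrating
these tails against the derivative of e^{(1-ε)y} gives (i). Part (ii) is (i) with ε = 1/ln N,
followed by Jensen's inequality for a power p ≤ 1. -/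

noncomputable section


/-! ### The operator inequality and its dual form -/

/-- The energies of the range of `(-Δ_Ω)^{-s}` are dense in the energies of the form domain. -/
lemma map_energyMap_le_closure {d : ℕ} {s : ℝ} (hd : 1 ≤ d) (hs : 0 < s) (Ω : Opens (RSpace d))
    (hΩ : Bornology.IsBounded (Ω : Set (RSpace d)))
    (Q : Submodule ℂ (extSobolev s Ω))
    (hQ : IsClosed (SetLike.coe (Q.map (energyMap s Ω)))) (v : extSobolev s Ω) (hv : v ∈ Q) :
    energyMap s Ω v ∈ closure {g | ∃ f : L2 Ω, ∃ w ∈ Q,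
      (w : L2 Ω) = fracLaplacianInv s Ω Q f ∧ energyMap s Ω w = g} := by
  have hT := isFracLaplacianInv_fracLaplacianInv hd hs Ω hΩ Q hQ
  set T := fracLaplacianInv s Ω Q
  let D : Submodule ℂ (Lp ℂ 2 (volume : Measure (RSpace d))) :=
    (Submodule.comap (extSobolev s Ω).subtype (LinearMap.range (T : L2 Ω →ₗ[ℂ] L2 Ω)) ⊓ Q).map
      (energyMap s Ω)
  have hD : (D : Set _) ⊆ {g | ∃ f : L2 Ω, ∃ w ∈ Q,
      (w : L2 Ω) = T f ∧ energyMap s Ω w = g} := by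
    rintro g ⟨w, ⟨⟨f, hf⟩, hwQ⟩, rfl⟩
    exact ⟨f, w, hwQ, hf.symm, rfl⟩
  refine closure_mono hD ?_
  rw [← Submodule.topologicalClosure_coe, SetLike.mem_coe]
  set K := D.topologicalClosure with hK
  have hKc : IsClosed (K : Set (Lp ℂ 2 (volume : Measure (RSpace d)))) := Submodule.isClosed_topologicalClosure D
  have : CompleteSpace K := hKc.completeSpace_coe
  have hDQ : D ≤ Q.map (energyMap s Ω) := Submodule.map_mono inf_le_right
  have hKQ : K ≤ Q.map (energyMap s Ω) := Submodule.topologicalClosure_minimal _ hDQ hQ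
  set p := K.starProjection (energyMap s Ω v) with hp
  have hpK : p ∈ K := Submodule.starProjection_apply_mem _ _
  obtain ⟨z, hzQ, hz⟩ := hKQ hpK
  have horth : ∀ g ∈ K, ⟪energyMap s Ω (v - z), g⟫_ℂ = 0 := fun g hg => by
    rw [map_sub, hz]
    exact Submodule.starProjection_inner_eq_zero _ _ hg
  -- Test the weak equation of w = (-Δ_Ω)^{-s}(v - z) with v - z itself: the form side vanishes by
  -- orthogonality, and the other side is ‖v - z‖² in L²(Ω).
  have hzero : ((v - z : extSobolev s Ω) : L2 Ω) = 0 := by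
    obtain ⟨w, hwQ, hw, h⟩ := (hT (v - z : extSobolev s Ω) _).1 rfl
    have h1 := h _ (Q.sub_mem hv hzQ)
    rw [horth _ (D.le_topologicalClosure ⟨w, ⟨⟨_, hw.symm⟩, hwQ⟩, rfl⟩)] at h1
    exact inner_self_eq_zero.1 h1.symm
  have hvz : v = z := sub_eq_zero.1 (Subtype.ext hzero)
  rw [hvz, hz]
  exact hpK

/-- The operator inequality `∑ |u_n⟩⟨u_n| ≤ (-Δ_Ω)^{-s}` in terms of the energies. -/
lemma sum_norm_inner_energyMap_sq_le {d : ℕ} {s : ℝ} (hd : 1 ≤ d) (hs : 0 < s)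
    (Ω : Opens (RSpace d)) (hΩ : Bornology.IsBounded (Ω : Set (RSpace d)))
    (Q : Submodule ℂ (extSobolev s Ω))
    (hQ : IsClosed (SetLike.coe (Q.map (energyMap s Ω))))
    {N : ℕ} (u : Fin N → extSobolev s Ω) (hu : ∀ n, u n ∈ Q)
    (hop : ∑ n, InnerProductSpace.rankOne ℂ (u n : L2 Ω) (u n : L2 Ω) ≤ fracLaplacianInv s Ω Q)
    (v : extSobolev s Ω) (hv : v ∈ Q) :
    ∑ n, ‖⟪energyMap s Ω (u n), energyMap s Ω v⟫_ℂ‖ ^ 2 ≤ ‖energyMap s Ω v‖ ^ 2 := by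
  have hT := isFracLaplacianInv_fracLaplacianInv hd hs Ω hΩ Q hQ
  have hcl : IsClosed {g : Lp ℂ 2 (volume : Measure (RSpace d)) |
      ∑ n, ‖⟪energyMap s Ω (u n), g⟫_ℂ‖ ^ 2 ≤ ‖g‖ ^ 2} :=
    isClosed_le (by fun_prop) (by fun_prop)
  -- Both sides are continuous in the energy, so v may be taken of the form w = (-Δ_Ω)^{-s} f. Then
  -- ⟨f, w⟩ is the energy of w and ⟨u_n, f⟩ is the form at (u_n, w), so the claim is the operator
  -- inequality tested on f.
  refine closure_minimal ?_ hcl (map_energyMap_le_closure hd hs Ω hΩ Q hQ v hv)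
  rintro g ⟨f, w, hwQ, hw, rfl⟩
  obtain ⟨w', hw'Q, hw', h⟩ := (hT f w).1 hw.symm
  obtain rfl : w' = w := Subtype.ext hw'
  have hpos := ((ContinuousLinearMap.le_def _ _).1 hop).re_inner_nonneg_right f
  rw [sub_apply, inner_sub_right, ← hw, map_sub, sub_nonneg] at hpos
  have h1 : RCLike.re ⟪f, (w' : L2 Ω)⟫_ℂ = ‖energyMap s Ω w'‖ ^ 2 := by
    rw [← inner_conj_symm, RCLike.conj_re, ← h w' hwQ, inner_self_eq_norm_sq]
  have h2 : RCLike.re ⟪f, (∑ n, InnerProductSpace.rankOne ℂ (u n : L2 Ω) (u n : L2 Ω)) f⟫_ℂ =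
      ∑ n, ‖⟪energyMap s Ω (u n), energyMap s Ω w'⟫_ℂ‖ ^ 2 := by
    rw [sum_apply, inner_sum, map_sum]
    refine Finset.sum_congr rfl fun n _ => ?_
    rw [InnerProductSpace.rankOne_apply, inner_smul_right, h _ (hu n), inner_mul_symm_re_eq_norm,
      norm_mul, norm_inner_symm f, sq]
  rw [h1, h2] at hpos
  exact hpos

/-- The dual form of `sum_norm_inner_energyMap_sq_le`. -/
lemma norm_energyMap_sum_sq_le {d : ℕ} {s : ℝ} (hd : 1 ≤ d) (hs : 0 < s)
    (Ω : Opens (RSpace d)) (hΩ : Bornology.IsBounded (Ω : Set (RSpace d)))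
    (Q : Submodule ℂ (extSobolev s Ω))
    (hQ : IsClosed (SetLike.coe (Q.map (energyMap s Ω))))
    {N : ℕ} (u : Fin N → extSobolev s Ω) (hu : ∀ n, u n ∈ Q)
    (hop : ∑ n, InnerProductSpace.rankOne ℂ (u n : L2 Ω) (u n : L2 Ω) ≤ fracLaplacianInv s Ω Q)
    (a : Fin N → ℂ) :
    ‖energyMap s Ω (∑ n, a n • u n)‖ ^ 2 ≤ ∑ n, ‖a n‖ ^ 2 := by
  set w := ∑ n, a n • u n with hw
  have hB := sum_norm_inner_energyMap_sq_le hd hs Ω hΩ Q hQ u hu hop w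
    (Q.sum_mem fun n _ => Q.smul_mem _ (hu n))
  have h1 : ‖energyMap s Ω w‖ ^ 2 ≤
      ∑ n, ‖a n‖ * ‖⟪energyMap s Ω (u n), energyMap s Ω w⟫_ℂ‖ := by
    have h2 : ⟪energyMap s Ω w, energyMap s Ω w⟫_ℂ =
        ∑ n, a n * ⟪energyMap s Ω w, energyMap s Ω (u n)⟫_ℂ := by
      conv_lhs => arg 3; rw [hw, map_sum]
      simp [inner_sum, inner_smul_right]
    calc ‖energyMap s Ω w‖ ^ 2 = ‖⟪energyMap s Ω w, energyMap s Ω w⟫_ℂ‖ := by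
          rw [inner_self_eq_norm_sq_to_K]; simp
      _ ≤ _ := by
          rw [h2]
          refine (norm_sum_le _ _).trans (Finset.sum_le_sum fun n _ => ?_)
          rw [norm_mul, norm_inner_symm]
  -- By AM–GM and `hB`, half of the energy of w is absorbed on the left.
  have h3 : ∑ n, ‖a n‖ * ‖⟪energyMap s Ω (u n), energyMap s Ω w⟫_ℂ‖ ≤
      ∑ n, (‖a n‖ ^ 2 + ‖⟪energyMap s Ω (u n), energyMap s Ω w⟫_ℂ‖ ^ 2) / 2 :=
    Finset.sum_le_sum fun n _ => by
      nlinarith [sq_nonneg (‖a n‖ - ‖⟪energyMap s Ω (u n), energyMap s Ω w⟫_ℂ‖)]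
  rw [← Finset.sum_div, Finset.sum_add_distrib] at h3
  linarith


/-! ### The semiclassical constant -/

/-- The constant `(2π)^d / ω_d`. -/
def semiclassicalConst (d : ℕ) : ℝ := (2 * Real.pi) ^ d / unitBallVolume d

lemma unitBallVolume_pos (d : ℕ) : 0 < unitBallVolume d :=
  ENNReal.toReal_pos (Metric.measure_ball_pos _ _ one_pos).ne' measure_ball_lt_top.ne

lemma semiclassicalConst_pos (d : ℕ) : 0 < semiclassicalConst d :=
  div_pos (by positivity) (unitBallVolume_pos d)

lemma unitBallVolume_le (d : ℕ) : unitBallVolume d ≤ 2 ^ d := by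
  have h : Metric.ball (0 : RSpace d) 1 ⊆
      (WithLp.ofLp : RSpace d → (Fin d → ℝ)) ⁻¹' (Set.pi Set.univ fun _ => Set.Icc (-1) 1) := by
    intro x hx i _
    have h1 : ‖x i‖ ≤ ‖x‖ := PiLp.norm_apply_le x i
    have h2 : ‖x‖ < 1 := by simpa using hx
    have h3 : |x i| ≤ 1 := by simpa using h1.trans h2.le
    exact ⟨(abs_le.1 h3).1, (abs_le.1 h3).2⟩
  have h4 := measure_mono (μ := (volume : Measure (RSpace d))) h
  have h6 := (EuclideanSpace.volume_preserving_symm_measurableEquiv_toLp (Fin d)).measure_preimage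
    (MeasurableSet.univ_pi fun _ => (measurableSet_Icc :
      MeasurableSet (Set.Icc (-1 : ℝ) 1))).nullMeasurableSet
  rw [volume_pi_pi] at h6
  replace h4 := h4.trans_eq h6
  have h5 := ENNReal.toReal_mono (by simp) h4
  refine h5.trans ?_
  simp only [Real.volume_Icc, Finset.prod_const, Finset.card_univ, Fintype.card_fin]
  rw [ENNReal.toReal_pow, ENNReal.toReal_ofReal (by norm_num)]
  norm_num

/-- The unit ball lies in the cube [-1,1]^d, so the constant is at least π^d. This uniform lower
bound pays for the numerical constants 22 and 4 of the theorem. -/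
lemma pi_le_semiclassicalConst {d : ℕ} (hd : 1 ≤ d) : Real.pi ≤ semiclassicalConst d := by
  rw [semiclassicalConst, le_div_iff₀ (unitBallVolume_pos d)]
  have h1 : Real.pi ≤ Real.pi ^ d :=
    le_self_pow₀ (by linarith [Real.pi_gt_three]) (by omega)
  calc Real.pi * unitBallVolume d ≤ Real.pi ^ d * 2 ^ d := by
        exact mul_le_mul h1 (unitBallVolume_le d) (unitBallVolume_pos d).le (by positivity)
    _ = _ := by rw [mul_pow, mul_comm]

lemma exists_radius {d : ℕ} (hd : 1 ≤ d) {X : ℝ} (hX : 0 < X) :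
    ∃ r : ℝ, 0 < r ∧ (2 * Real.pi * r) ^ d = X := by
  refine ⟨X ^ ((d : ℝ)⁻¹) / (2 * Real.pi), by positivity, ?_⟩
  rw [mul_div_cancel₀ _ (by positivity), Real.rpow_inv_natCast_pow hX.le (by omega)]

lemma volume_real_ball {d : ℕ} {r : ℝ} (hr : 0 < r) :
    (volume : Measure (RSpace d)).real (Metric.ball 0 r) =
      (2 * Real.pi * r) ^ d / semiclassicalConst d := by
  have := unitBallVolume_pos d
  rw [Measure.real, Measure.addHaar_ball_of_pos _ _ hr, ENNReal.toReal_mul,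
    ENNReal.toReal_ofReal (by positivity), semiclassicalConst, unitBallVolume,
    finrank_euclideanSpace_fin, mul_pow]
  rw [unitBallVolume] at this
  field_simp

/-! ### Fourier transforms, energies and the Poincaré inequality -/

/-- On `L²(ℝ^d) ∩ L¹(ℝ^d)` the inverse Fourier transform is given by the integral. -/
lemma fourierInv_ae_eq_integral {d : ℕ} (U : Lp ℂ 2 (volume : Measure (RSpace d)))
    (hU : Integrable U volume) :
    ((𝓕⁻ U : Lp ℂ 2 (volume : Measure (RSpace d))) : RSpace d → ℂ) =ᵐ[volume]
      𝓕⁻ (U : RSpace d → ℂ) := by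
  have hL : Continuous fun p : RSpace d × RSpace d => (-innerₗ (RSpace d)) p.1 p.2 := by
    simp only [LinearMap.neg_apply, innerₗ_apply_apply]
    fun_prop
  have hc : Continuous (𝓕⁻ (U : RSpace d → ℂ)) :=
    VectorFourier.fourierIntegral_continuous Real.continuous_fourierChar hL hU
  refine ae_eq_of_integral_contDiff_smul_eq
    ((Lp.memLp _).locallyIntegrable (by norm_num)) hc.locallyIntegrable fun g hg hgc => ?_
  have hg₁ : HasCompactSupport (Complex.ofRealCLM ∘ g) := hgc.comp_left rfl
  have hg₂ : ContDiff ℝ ∞ (Complex.ofRealCLM ∘ g) := by fun_prop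
  set G : SchwartzMap (RSpace d) ℂ := hg₁.toSchwartzMap hg₂ with hG
  have e1 := congrArg (fun T => T G) (Lp.fourierInv_toTemperedDistribution_eq U)
  simp only [TemperedDistribution.fourierInv_apply, Lp.toTemperedDistribution_apply] at e1
  have e2 := VectorFourier.integral_fourierIntegral_smul_eq_flip (L := -innerₗ (RSpace d))
    (f := (G : RSpace d → ℂ)) (g := (U : RSpace d → ℂ)) (μ := volume) (ν := volume)
    Real.continuous_fourierChar hL G.integrable hU
  have hflip : (-innerₗ (RSpace d)).flip = -innerₗ (RSpace d) := by
    ext x y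
    simp [real_inner_comm]
  rw [hflip] at e2
  have e3 : ∫ x, (G x) • (𝓕⁻ U : Lp ℂ 2 (volume : Measure (RSpace d))) x
      = ∫ x, G x • 𝓕⁻ (U : RSpace d → ℂ) x := by
    rw [← e1, SchwartzMap.fourierInv_coe]
    exact e2
  simpa [hG] using e3

/-- Cauchy–Schwarz on Ω; the explicit factor |Ω| is what gives the Poincaré constant its order
c/|Ω|. -/
lemma norm_fourier_extendByZero_le {d : ℕ} (Ω : Opens (RSpace d))
    (hΩ : Bornology.IsBounded (Ω : Set (RSpace d))) (u : L2 Ω) :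
    ∀ᵐ ξ, ‖(𝓕 (extendByZero Ω u)) ξ‖ ^ 2 ≤
      (volume : Measure (RSpace d)).real Ω * ‖u‖ ^ 2 := by
  have hfin : IsFiniteMeasure ((volume : Measure (RSpace d)).restrict (Ω : Set (RSpace d))) :=
    ⟨by simpa using hΩ.measure_lt_top⟩
  set μ := (volume : Measure (RSpace d)).restrict (Ω : Set (RSpace d)) with hμ
  have hu1 : MemLp u 1 μ := (Lp.memLp u).mono_exponent (by norm_num)
  have hext : (extendByZero Ω u : RSpace d → ℂ) =ᵐ[volume]
      (Ω : Set (RSpace d)).indicator u := MemLp.coeFn_toLp (memLp_extend Ω u)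
  have hint : Integrable (extendByZero Ω u : RSpace d → ℂ) volume := by
    rw [integrable_congr hext, integrable_indicator_iff Ω.isOpen.measurableSet]
    exact memLp_one_iff_integrable.1 hu1
  have hbd : ∫ x, ‖(extendByZero Ω u) x‖ ≤
      Real.sqrt ((volume : Measure (RSpace d)).real Ω) * ‖u‖ := by
    have h1 : ∫ x, ‖(extendByZero Ω u) x‖ = (eLpNorm u 1 μ).toReal := by
      rw [integral_norm_eq_lintegral_enorm hint.1, ← eLpNorm_one_eq_lintegral_enorm,
        eLpNorm_congr_ae hext, eLpNorm_indicator_eq_eLpNorm_restrict Ω.isOpen.measurableSet]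
    have h2 : Real.sqrt ((volume : Measure (RSpace d)).real Ω) =
        (μ Set.univ ^ (1 / (1 : ℝ≥0∞).toReal - 1 / (2 : ℝ≥0∞).toReal)).toReal := by
      rw [← ENNReal.toReal_rpow, Real.sqrt_eq_rpow, hμ, Measure.restrict_apply_univ, Measure.real]
      norm_num
    rw [h1, Lp.norm_def, mul_comm, h2, ← ENNReal.toReal_mul]
    refine ENNReal.toReal_mono (ENNReal.mul_ne_top (Lp.memLp u).2.ne
      (ENNReal.rpow_ne_top_of_nonneg (by norm_num) (measure_ne_top _ _))) ?_
    exact eLpNorm_le_eLpNorm_mul_rpow_measure_univ (by norm_num) (Lp.memLp u).1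
  filter_upwards [fourier_ae_eq_integral _ hint] with ξ hξ
  rw [hξ, ← Real.sq_sqrt (measureReal_nonneg (μ := volume) (s := (Ω : Set (RSpace d)))), ← mul_pow]
  gcongr
  exact (VectorFourier.norm_fourierIntegral_le_integral_norm _ _ _ _ _).trans hbd

lemma integrable_norm_sq {d : ℕ} (f : Lp ℂ 2 (volume : Measure (RSpace d))) :
    Integrable fun x => ‖f x‖ ^ 2 :=
  (memLp_two_iff_integrable_sq_norm (Lp.memLp f).1).1 (Lp.memLp f)

lemma norm_sq_eq_integral {d : ℕ} (f : Lp ℂ 2 (volume : Measure (RSpace d))) :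
    ‖f‖ ^ 2 = ∫ x, ‖f x‖ ^ 2 := by
  have h := norm_sq_eq_lintegral f
  rw [← ofReal_integral_eq_lintegral_ofReal (integrable_norm_sq f)
    (Filter.Eventually.of_forall fun x => by positivity)] at h
  exact (ENNReal.ofReal_eq_ofReal_iff (by positivity)
    (integral_nonneg fun x => by positivity)).1 h

lemma integral_norm_fourier_sq {d : ℕ} {Ω : Opens (RSpace d)} (u : L2 Ω) :
    ∫ ξ, ‖(𝓕 (extendByZero Ω u)) ξ‖ ^ 2 = ‖u‖ ^ 2 := by
  rw [← norm_sq_eq_integral, Lp.norm_fourier_eq, LinearIsometry.norm_map]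

lemma norm_fracSymbol_sq {d : ℕ} {s : ℝ} (hs : s = (d : ℝ) / 2) {Ω : Opens (RSpace d)} (u : L2 Ω)
    (ξ : RSpace d) :
    ‖fracSymbol s u ξ‖ ^ 2 = (2 * Real.pi * ‖ξ‖) ^ d * ‖(𝓕 (extendByZero Ω u)) ξ‖ ^ 2 := by
  rw [fracSymbol, norm_mul, Complex.norm_real, Real.norm_of_nonneg (by positivity), mul_pow,
    ← Real.rpow_natCast, ← Real.rpow_mul (norm_nonneg _), hs, norm_smul,
    Real.norm_of_nonneg (by positivity)]
  simp

lemma integrable_pow_mul_norm_fourier_sq {d : ℕ} {s : ℝ} (hs : s = (d : ℝ) / 2)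
    {Ω : Opens (RSpace d)} (w : extSobolev s Ω) :
    Integrable fun ξ : RSpace d =>
      (2 * Real.pi * ‖ξ‖) ^ d * ‖(𝓕 (extendByZero Ω (w : L2 Ω))) ξ‖ ^ 2 := by
  simp_rw [← norm_fracSymbol_sq hs]
  exact (memLp_two_iff_integrable_sq_norm (memLp_fracSymbol w).1).1 (memLp_fracSymbol w)

lemma norm_energyMap_sq {d : ℕ} {s : ℝ} (hs : s = (d : ℝ) / 2)
    {Ω : Opens (RSpace d)} (w : extSobolev s Ω) :
    ‖energyMap s Ω w‖ ^ 2 = ∫ ξ : RSpace d,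
      (2 * Real.pi * ‖ξ‖) ^ d * ‖(𝓕 (extendByZero Ω (w : L2 Ω))) ξ‖ ^ 2 := by
  rw [norm_sq_eq_integral]
  refine integral_congr_ae ?_
  have h : (energyMap s Ω w : RSpace d → ℂ) =ᵐ[volume] fracSymbol s (w : L2 Ω) :=
    MemLp.coeFn_toLp (memLp_fracSymbol w)
  filter_upwards [h] with ξ hξ
  rw [hξ, norm_fracSymbol_sq hs]

/-- A Poincaré inequality with a constant of the semiclassical order. -/
lemma mul_norm_sq_le_norm_energyMap_sq {d : ℕ} (hd : 1 ≤ d) {s : ℝ} (hs : s = (d : ℝ) / 2)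
    (Ω : Opens (RSpace d)) (hΩ : Bornology.IsBounded (Ω : Set (RSpace d)))
    (hV : 0 < (volume : Measure (RSpace d)).real Ω) (w : extSobolev s Ω) :
    semiclassicalConst d / (4 * (volume : Measure (RSpace d)).real Ω) * ‖(w : L2 Ω)‖ ^ 2 ≤
      ‖energyMap s Ω w‖ ^ 2 := by
  set V := (volume : Measure (RSpace d)).real Ω with hVd
  have hc := semiclassicalConst_pos d
  -- The ball with (2πr)^d = K has volume K/c = 1/(2V), so it carries at most half of the L² mass of
  -- û. Outside it the symbol is at least K.
  set K := semiclassicalConst d / (2 * V) with hK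
  obtain ⟨r, hr, hrK⟩ := exists_radius hd (show 0 < K by positivity)
  set F := 𝓕 (extendByZero Ω (w : L2 Ω)) with hF
  have hpt : ∀ᵐ ξ : RSpace d, K * ‖F ξ‖ ^ 2 ≤
      (Metric.ball (0 : RSpace d) r).indicator (fun _ => K * (V * ‖(w : L2 Ω)‖ ^ 2)) ξ +
      (2 * Real.pi * ‖ξ‖) ^ d * ‖F ξ‖ ^ 2 := by
    filter_upwards [norm_fourier_extendByZero_le Ω hΩ (w : L2 Ω)] with ξ h1
    by_cases hξ : ξ ∈ Metric.ball (0 : RSpace d) r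
    · rw [Set.indicator_of_mem hξ]
      have h2 : K * ‖F ξ‖ ^ 2 ≤ K * (V * ‖(w : L2 Ω)‖ ^ 2) := by gcongr
      have h3 : 0 ≤ (2 * Real.pi * ‖ξ‖) ^ d * ‖F ξ‖ ^ 2 := by positivity
      linarith
    · rw [Set.indicator_of_notMem hξ, zero_add, ← hrK]
      have hξr : r ≤ ‖ξ‖ := by simpa using hξ
      gcongr
  have hB : Integrable ((Metric.ball (0 : RSpace d) r).indicator
      fun _ => K * (V * ‖(w : L2 Ω)‖ ^ 2)) :=
    (integrable_indicator_iff Metric.isOpen_ball.measurableSet).2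
      (integrableOn_const measure_ball_lt_top.ne)
  have hi := integral_mono_ae ((integrable_norm_sq F).const_mul K)
    (hB.add (integrable_pow_mul_norm_fourier_sq hs w)) hpt
  have hadd := integral_add hB (integrable_pow_mul_norm_fourier_sq hs w)
  simp only [Pi.add_apply] at hi
  rw [hadd, integral_const_mul, integral_norm_fourier_sq, ← norm_energyMap_sq hs,
    integral_indicator_const _ Metric.isOpen_ball.measurableSet, volume_real_ball hr, hrK,
    smul_eq_mul] at hi
  have h5 : K / semiclassicalConst d * (K * (V * ‖(w : L2 Ω)‖ ^ 2)) =
      K / 2 * ‖(w : L2 Ω)‖ ^ 2 := by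
    rw [hK]; field_simp
  have h6 : semiclassicalConst d / (4 * V) = K / 2 := by rw [hK]; field_simp; norm_num
  rw [h6]
  linarith


/-! ### The low frequencies -/

/-- The Fourier multiplier `(1 - θ) |2πξ|^d + θ Λ` as a function of `|ξ|`. -/
def mixedWeight (d : ℕ) (θ Λ t : ℝ) : ℝ := (1 - θ) * (2 * Real.pi * t) ^ d + θ * Λ

lemma mixedWeight_pos (d : ℕ) {θ Λ t : ℝ} (hθ : 0 < θ) (hθ1 : θ < 1) (hΛ : 0 < Λ) (ht : 0 ≤ t) :
    0 < mixedWeight d θ Λ t := by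
  have : 0 ≤ (1 - θ) * (2 * Real.pi * t) ^ d := mul_nonneg (by linarith) (by positivity)
  have := mul_pos hθ hΛ
  rw [mixedWeight]
  linarith

lemma integrable_mixedWeight_mul {d : ℕ} {s : ℝ} (hs : s = (d : ℝ) / 2) {Ω : Opens (RSpace d)}
    (θ Λ : ℝ) (w : extSobolev s Ω) :
    Integrable fun ξ : RSpace d =>
      mixedWeight d θ Λ ‖ξ‖ * ‖(𝓕 (extendByZero Ω (w : L2 Ω))) ξ‖ ^ 2 := by
  simp only [mixedWeight, add_mul, mul_assoc (1 - θ)]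
  exact ((integrable_pow_mul_norm_fourier_sq hs w).const_mul (1 - θ)).add
    ((integrable_norm_sq _).const_mul (θ * Λ))

/-- The weighted integral is the convex combination, with weights 1 - θ and θ, of the energy and
Λ‖w‖². -/
lemma integral_mixedWeight_mul_le {d : ℕ} {s : ℝ} (hs : s = (d : ℝ) / 2) {Ω : Opens (RSpace d)}
    {θ Λ : ℝ} (hθ : 0 ≤ θ) (w : extSobolev s Ω)
    (hw : Λ * ‖(w : L2 Ω)‖ ^ 2 ≤ ‖energyMap s Ω w‖ ^ 2) :
    ∫ ξ : RSpace d, mixedWeight d θ Λ ‖ξ‖ * ‖(𝓕 (extendByZero Ω (w : L2 Ω))) ξ‖ ^ 2 ≤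
      ‖energyMap s Ω w‖ ^ 2 := by
  simp only [mixedWeight, add_mul, mul_assoc (1 - θ)]
  rw [integral_add ((integrable_pow_mul_norm_fourier_sq hs w).const_mul (1 - θ))
    ((integrable_norm_sq _).const_mul (θ * Λ)), integral_const_mul, integral_const_mul,
    ← norm_energyMap_sq hs, integral_norm_fourier_sq]
  nlinarith [mul_le_mul_of_nonneg_left hw hθ]

/-- The part of `u` with frequencies in `|ξ| < r`. -/
def lowFrequency {d : ℕ} {Ω : Opens (RSpace d)} (r : ℝ) (u : L2 Ω) (x : RSpace d) : ℂ :=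
  ∫ ξ in Metric.ball (0 : RSpace d) r, Real.fourierChar ⟪ξ, x⟫_ℝ • (𝓕 (extendByZero Ω u)) ξ

lemma integrableOn_ball_fourier {d : ℕ} {Ω : Opens (RSpace d)} (r : ℝ) (u : L2 Ω) :
    IntegrableOn (fun ξ => (𝓕 (extendByZero Ω u)) ξ) (Metric.ball 0 r) :=
  (((Lp.memLp (𝓕 (extendByZero Ω u))).locallyIntegrable (by norm_num)).integrableOn_isCompact
    (isCompact_closedBall 0 r)).mono_set Metric.ball_subset_closedBall

lemma integrableOn_ball_fourierChar_smul {d : ℕ} {Ω : Opens (RSpace d)} (r : ℝ) (u : L2 Ω)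
    (x : RSpace d) :
    IntegrableOn (fun ξ => Real.fourierChar ⟪ξ, x⟫_ℝ • (𝓕 (extendByZero Ω u)) ξ)
      (Metric.ball 0 r) := by
  have h := integrableOn_ball_fourier r u
  refine (integrable_norm_iff ?_).1 ?_
  · refine AEStronglyMeasurable.smul (𝕜 := Circle) ?_ h.1
    exact (Real.continuous_fourierChar.comp (by fun_prop)).aestronglyMeasurable
  · simpa using h.norm

/-- Since the low part is an honest integral over a bounded set, linearity holds at every x and not
merely almost everywhere. The pointwise duality argument needs this, as its coefficients depend on
x. -/
lemma lowFrequency_sum_smul {d N : ℕ} {Ω : Opens (RSpace d)} (r : ℝ) (u : Fin N → L2 Ω)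
    (a : Fin N → ℂ) (x : RSpace d) :
    lowFrequency r (∑ n, a n • u n) x = ∑ n, a n * lowFrequency r (u n) x := by
  have h1 : 𝓕 (extendByZero Ω (∑ n, a n • u n)) = ∑ n, a n • 𝓕 (extendByZero Ω (u n)) := by
    change Lp.fourierTransformₗᵢ (RSpace d) ℂ _ = ∑ n, a n • Lp.fourierTransformₗᵢ (RSpace d) ℂ _
    simp
  have h2 : (fun ξ => (𝓕 (extendByZero Ω (∑ n, a n • u n))) ξ) =ᵐ[volume]
      fun ξ => ∑ n, a n * (𝓕 (extendByZero Ω (u n))) ξ := by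
    rw [h1]
    have h3 : ∀ᵐ ξ, ∀ n, (a n • 𝓕 (extendByZero Ω (u n)) : Lp ℂ 2 volume) ξ =
        a n * (𝓕 (extendByZero Ω (u n))) ξ := by
      refine ae_all_iff.2 fun n => ?_
      filter_upwards [Lp.coeFn_smul (a n) (𝓕 (extendByZero Ω (u n)))] with ξ hξ
      simpa using hξ
    filter_upwards [Lp.coeFn_finsetSum Finset.univ fun n => a n • 𝓕 (extendByZero Ω (u n)), h3]
      with ξ h4 h5
    rw [h4, Finset.sum_apply]
    exact Finset.sum_congr rfl fun n _ => h5 n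
  unfold lowFrequency
  simp_rw [← integral_const_mul]
  rw [← integral_finsetSum _ fun n _ => (integrableOn_ball_fourierChar_smul r (u n) x).const_mul _]
  refine integral_congr_ae (ae_restrict_of_ae ?_)
  filter_upwards [h2] with ξ hξ
  rw [hξ, Finset.smul_sum]
  refine Finset.sum_congr rfl fun n _ => ?_
  simp only [Circle.smul_def, smul_eq_mul]
  ring

lemma continuous_mixedWeight_inv (d : ℕ) {θ Λ : ℝ} (hθ : 0 < θ) (hθ1 : θ < 1) (hΛ : 0 < Λ) :
    Continuous fun ξ : RSpace d => (mixedWeight d θ Λ ‖ξ‖)⁻¹ :=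
  Continuous.inv₀ (by unfold mixedWeight; fun_prop)
    fun ξ => (mixedWeight_pos d hθ hθ1 hΛ (norm_nonneg ξ)).ne'

/-- The pointwise bound on the density of the low frequencies. -/
lemma sum_norm_lowFrequency_sq_le {d N : ℕ} {s : ℝ} (hs : s = (d : ℝ) / 2) {Ω : Opens (RSpace d)}
    {θ Λ : ℝ} (hθ : 0 < θ) (hθ1 : θ < 1) (hΛ : 0 < Λ)
    (hP : ∀ w : extSobolev s Ω, Λ * ‖(w : L2 Ω)‖ ^ 2 ≤ ‖energyMap s Ω w‖ ^ 2)
    (u : Fin N → extSobolev s Ω)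
    (hu : ∀ a : Fin N → ℂ, ‖energyMap s Ω (∑ n, a n • u n)‖ ^ 2 ≤ ∑ n, ‖a n‖ ^ 2)
    (r : ℝ) (x : RSpace d) :
    ∑ n, ‖lowFrequency r (u n : L2 Ω) x‖ ^ 2 ≤
      ∫ ξ in Metric.ball (0 : RSpace d) r, (mixedWeight d θ Λ ‖ξ‖)⁻¹ := by
  -- With these conjugate coefficients the low part of w at x is S, while the contraction bounds the
  -- energy of w by the same S.
  set a : Fin N → ℂ := fun n => starRingEnd ℂ (lowFrequency r (u n : L2 Ω) x) with ha
  set S := ∑ n, ‖lowFrequency r (u n : L2 Ω) x‖ ^ 2 with hS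
  set w := ∑ n, a n • u n with hw
  have hwc : (w : L2 Ω) = ∑ n, a n • (u n : L2 Ω) := by simp [hw]
  have h1 : (S : ℂ) = lowFrequency r (w : L2 Ω) x := by
    rw [hwc, lowFrequency_sum_smul, hS]
    push_cast
    exact Finset.sum_congr rfl fun n _ => (Complex.conj_mul' _).symm
  set F := 𝓕 (extendByZero Ω (w : L2 Ω)) with hF
  have hS0 : 0 ≤ S := Finset.sum_nonneg fun n _ => by positivity
  have h2 : S ≤ ∫ ξ in Metric.ball (0 : RSpace d) r, ‖F ξ‖ := by
    calc S = ‖(S : ℂ)‖ := by rw [Complex.norm_real, Real.norm_of_nonneg hS0]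
      _ ≤ ∫ ξ in Metric.ball (0 : RSpace d) r, ‖Real.fourierChar ⟪ξ, x⟫_ℝ • F ξ‖ := by
          rw [h1]; exact norm_integral_le_integral_norm _
      _ = _ := by simp
  have hi1 : IntegrableOn (fun ξ : RSpace d => (mixedWeight d θ Λ ‖ξ‖)⁻¹ / 2)
      (Metric.ball 0 r) :=
    (((continuous_mixedWeight_inv d hθ hθ1 hΛ).div_const 2).continuousOn.integrableOn_compact
      (isCompact_closedBall 0 r)).mono_set Metric.ball_subset_closedBall
  have hi2 := (integrable_mixedWeight_mul hs θ Λ w).div_const 2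
  have h3 : ∫ ξ in Metric.ball (0 : RSpace d) r, ‖F ξ‖ ≤
      ∫ ξ in Metric.ball (0 : RSpace d) r, ((mixedWeight d θ Λ ‖ξ‖)⁻¹ / 2 +
        mixedWeight d θ Λ ‖ξ‖ * ‖F ξ‖ ^ 2 / 2) := by
    refine integral_mono (integrableOn_ball_fourier r _).norm
      (hi1.add hi2.integrableOn) fun ξ => ?_
    have hm := mixedWeight_pos d hθ hθ1 hΛ (norm_nonneg ξ)
    -- The completed square behind |F| ≤ 1/(2m) + m|F|²/2 for the weight m. The second term
    -- integrates to at most S/2, which is absorbed.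
    have h4 : 0 ≤ (mixedWeight d θ Λ ‖ξ‖)⁻¹ * (mixedWeight d θ Λ ‖ξ‖ * ‖F ξ‖ - 1) ^ 2 := by
      positivity
    have h5 : (mixedWeight d θ Λ ‖ξ‖)⁻¹ * (mixedWeight d θ Λ ‖ξ‖ * ‖F ξ‖ - 1) ^ 2 =
        mixedWeight d θ Λ ‖ξ‖ * ‖F ξ‖ ^ 2 - 2 * ‖F ξ‖ + (mixedWeight d θ Λ ‖ξ‖)⁻¹ := by
      field_simp
      ring
    simp only
    linarith
  rw [integral_add hi1 hi2.integrableOn, integral_div, integral_div] at h3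
  have h6 : ∫ ξ in Metric.ball (0 : RSpace d) r, mixedWeight d θ Λ ‖ξ‖ * ‖F ξ‖ ^ 2 ≤
      ∫ ξ : RSpace d, mixedWeight d θ Λ ‖ξ‖ * ‖F ξ‖ ^ 2 :=
    setIntegral_le_integral (integrable_mixedWeight_mul hs θ Λ w)
      (Filter.Eventually.of_forall fun ξ =>
        mul_nonneg (mixedWeight_pos d hθ hθ1 hΛ (norm_nonneg ξ)).le (by positivity))
  have h7 := integral_mixedWeight_mul_le hs hθ.le w (hP w)
  have h8 : ∑ n, ‖a n‖ ^ 2 = S := Finset.sum_congr rfl fun n _ => by simp [ha]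
  have h9 := hu a
  rw [h8] at h9
  linarith

/-- The integral of the inverse weight over a ball. -/
lemma integral_ball_mixedWeight_inv {d : ℕ} (hd : 1 ≤ d) {θ Λ : ℝ} (hθ : 0 < θ) (hθ1 : θ < 1)
    (hΛ : 0 < Λ) {r : ℝ} (hr : 0 < r) :
    ∫ ξ in Metric.ball (0 : RSpace d) r, (mixedWeight d θ Λ ‖ξ‖)⁻¹ =
      Real.log (1 + (1 - θ) * (2 * Real.pi * r) ^ d / (θ * Λ)) /
        (semiclassicalConst d * (1 - θ)) := by
  have hne : Nonempty (Fin d) := ⟨⟨0, hd⟩⟩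
  have hω := unitBallVolume_pos d
  have hθ' : 0 < 1 - θ := by linarith
  rw [← integral_indicator Metric.isOpen_ball.measurableSet]
  have h1 : ((Metric.ball (0 : RSpace d) r).indicator fun ξ => (mixedWeight d θ Λ ‖ξ‖)⁻¹) =
      fun ξ : RSpace d => (Set.Iio r).indicator (fun t => (mixedWeight d θ Λ t)⁻¹) ‖ξ‖ := by
    ext ξ
    simp [Set.indicator]
  rw [h1, integral_fun_norm_addHaar volume
    ((Set.Iio r).indicator fun t => (mixedWeight d θ Λ t)⁻¹), finrank_euclideanSpace_fin]
  have h2 : ∫ y in Set.Ioi (0 : ℝ), y ^ (d - 1) •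
      (Set.Iio r).indicator (fun t => (mixedWeight d θ Λ t)⁻¹) y =
      ∫ y in (0 : ℝ)..r, y ^ (d - 1) * (mixedWeight d θ Λ y)⁻¹ := by
    rw [intervalIntegral.integral_of_le hr.le, integral_Ioc_eq_integral_Ioo,
      ← Set.Ioi_inter_Iio, ← setIntegral_indicator measurableSet_Iio]
    refine integral_congr_ae (Filter.Eventually.of_forall fun y => ?_)
    by_cases hy : y ∈ Set.Iio r <;> simp [hy]
  have hD : (d : ℝ) ≠ 0 := by positivity
  -- In polar coordinates the Jacobian y^(d-1) is proportional to the derivative of the weight, so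
  -- the integrand is a logarithmic derivative.
  have h3 : ∀ y ∈ Set.uIcc 0 r, HasDerivAt
      (fun y => Real.log (mixedWeight d θ Λ y) / (d * ((1 - θ) * (2 * Real.pi) ^ d)))
      (y ^ (d - 1) * (mixedWeight d θ Λ y)⁻¹) y := by
    intro y hy
    rw [Set.uIcc_of_le hr.le] at hy
    have hm := mixedWeight_pos d hθ hθ1 hΛ hy.1
    have h4 : HasDerivAt (mixedWeight d θ Λ)
        ((1 - θ) * (d * (2 * Real.pi * y) ^ (d - 1) * (2 * Real.pi))) y := by
      have h5 := ((((hasDerivAt_id y).const_mul (2 * Real.pi)).pow d).const_mul (1 - θ)).add_const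
        (θ * Λ)
      simp only [id_eq, mul_one] at h5
      exact h5
    refine ((h4.log hm.ne').div_const (d * ((1 - θ) * (2 * Real.pi) ^ d))).congr_deriv ?_
    obtain ⟨k, rfl⟩ : ∃ k, d = k + 1 := ⟨d - 1, by omega⟩
    rw [Nat.add_sub_cancel, mul_pow, pow_succ]
    field_simp
  have h6 : IntervalIntegrable (fun y => y ^ (d - 1) * (mixedWeight d θ Λ y)⁻¹) volume 0 r := by
    refine ContinuousOn.intervalIntegrable ?_
    rw [Set.uIcc_of_le hr.le]
    refine ContinuousOn.mul (by fun_prop) (ContinuousOn.inv₀ (by unfold mixedWeight; fun_prop) ?_)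
    exact fun y hy => (mixedWeight_pos d hθ hθ1 hΛ hy.1).ne'
  rw [h2, intervalIntegral.integral_eq_sub_of_hasDerivAt h3 h6, ← sub_div,
    ← Real.log_div (mixedWeight_pos d hθ hθ1 hΛ hr.le).ne' (mixedWeight_pos d hθ hθ1 hΛ le_rfl).ne']
  have h7 : mixedWeight d θ Λ r / mixedWeight d θ Λ 0 =
      1 + (1 - θ) * (2 * Real.pi * r) ^ d / (θ * Λ) := by
    have : d ≠ 0 := by omega
    simp only [mixedWeight, mul_zero, zero_pow this, zero_add]
    field_simp
    ring
  rw [h7, semiclassicalConst, nsmul_eq_mul, smul_eq_mul]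
  change _ * (unitBallVolume d * _) = _
  field_simp

/-! ### The high frequencies -/

/-- The bound on the high frequencies. -/
lemma lintegral_sub_lowFrequency_sq_le {d : ℕ} {s : ℝ} (hs : s = (d : ℝ) / 2)
    {Ω : Opens (RSpace d)} {r : ℝ} (hr : 0 < r) (u : extSobolev s Ω) :
    ∫⁻ x in (Ω : Set (RSpace d)),
        ENNReal.ofReal (‖((u : L2 Ω) : RSpace d → ℂ) x - lowFrequency r (u : L2 Ω) x‖ ^ 2) ≤
      ENNReal.ofReal (‖energyMap s Ω u‖ ^ 2 / (2 * Real.pi * r) ^ d) := by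
  set F := 𝓕 (extendByZero Ω (u : L2 Ω)) with hF
  have hB := (Metric.isOpen_ball (x := (0 : RSpace d)) (ε := r)).measurableSet
  have hGm : MemLp ((Metric.ball (0 : RSpace d) r).indicator F) 2 volume :=
    (Lp.memLp F).indicator hB
  set G : Lp ℂ 2 (volume : Measure (RSpace d)) := hGm.toLp _ with hG
  have hGae : (G : RSpace d → ℂ) =ᵐ[volume] (Metric.ball (0 : RSpace d) r).indicator F :=
    MemLp.coeFn_toLp hGm
  have hGint : Integrable G volume := by
    rw [integrable_congr hGae, integrable_indicator_iff hB]
    exact integrableOn_ball_fourier r _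
  have hlow : ((𝓕⁻ G : Lp ℂ 2 (volume : Measure (RSpace d))) : RSpace d → ℂ) =ᵐ[volume]
      lowFrequency r (u : L2 Ω) := by
    filter_upwards [fourierInv_ae_eq_integral G hGint] with x hx
    rw [hx, Real.fourierInv_eq, lowFrequency, ← integral_indicator hB]
    refine integral_congr_ae ?_
    filter_upwards [hGae] with ξ hξ
    rw [hξ]
    by_cases h : ξ ∈ Metric.ball (0 : RSpace d) r
    · rw [Set.indicator_of_mem h, Set.indicator_of_mem h]
    · rw [Set.indicator_of_notMem h, Set.indicator_of_notMem h, smul_zero]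
  -- H is the high part on all of ℝ^d. Its Fourier transform is û cut off to |ξ| ≥ r, where (2πr)^d
  -- ≤ |2πξ|^d.
  set H : Lp ℂ 2 (volume : Measure (RSpace d)) := extendByZero Ω (u : L2 Ω) - 𝓕⁻ G with hH
  have hnorm : ‖H‖ = ‖F - G‖ := by
    have h1 : 𝓕 H = F - 𝓕 (𝓕⁻ G) := map_sub (Lp.fourierTransformₗᵢ (RSpace d) ℂ) _ _
    rw [← Lp.norm_fourier_eq H, h1, FourierInvPair.fourier_fourierInv_eq]
  have hHae : ∀ᵐ x ∂volume.restrict (Ω : Set (RSpace d)),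
      ((u : L2 Ω) : RSpace d → ℂ) x - lowFrequency r (u : L2 Ω) x = H x := by
    have hext : (extendByZero Ω (u : L2 Ω) : RSpace d → ℂ) =ᵐ[volume]
        (Ω : Set (RSpace d)).indicator (u : L2 Ω) := MemLp.coeFn_toLp (memLp_extend Ω _)
    filter_upwards [ae_restrict_of_ae hlow, ae_restrict_of_ae hext,
      ae_restrict_of_ae (Lp.coeFn_sub (extendByZero Ω (u : L2 Ω)) (𝓕⁻ G)),
      ae_restrict_mem Ω.isOpen.measurableSet] with x h1 h2 h3 h4
    rw [h3, Pi.sub_apply, h1, h2, Set.indicator_of_mem h4]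
  calc _ = ∫⁻ x in (Ω : Set (RSpace d)), ENNReal.ofReal (‖H x‖ ^ 2) :=
        lintegral_congr_ae (by filter_upwards [hHae] with x hx; rw [hx])
    _ ≤ ∫⁻ x, ENNReal.ofReal (‖H x‖ ^ 2) := setLIntegral_le_lintegral _ _
    _ = ENNReal.ofReal (‖F - G‖ ^ 2) := by rw [← norm_sq_eq_lintegral, hnorm]
    _ ≤ _ := ENNReal.ofReal_le_ofReal ?_
  rw [norm_sq_eq_integral, norm_energyMap_sq hs, ← integral_div]
  refine integral_mono_ae (integrable_norm_sq _)
    ((integrable_pow_mul_norm_fourier_sq hs u).div_const _) ?_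
  filter_upwards [hGae, Lp.coeFn_sub F G] with ξ h1 h2
  rw [h2, Pi.sub_apply, h1]
  by_cases h : ξ ∈ Metric.ball (0 : RSpace d) r
  · rw [Set.indicator_of_mem h, sub_self, norm_zero, zero_pow two_ne_zero]
    positivity
  · rw [Set.indicator_of_notMem h, sub_zero, le_div_iff₀ (by positivity), mul_comm]
    have hξ : r ≤ ‖ξ‖ := by simpa using h
    gcongr


lemma continuous_lowFrequency {d : ℕ} {Ω : Opens (RSpace d)} (r : ℝ) (u : L2 Ω) :
    Continuous (lowFrequency r u) := by
  have hB := (Metric.isOpen_ball (x := (0 : RSpace d)) (ε := r)).measurableSet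
  have hL : Continuous fun p : RSpace d × RSpace d => (-innerₗ (RSpace d)) p.1 p.2 := by
    simp only [LinearMap.neg_apply, innerₗ_apply_apply]
    fun_prop
  have h : lowFrequency r u =
      𝓕⁻ ((Metric.ball (0 : RSpace d) r).indicator fun ξ => (𝓕 (extendByZero Ω u)) ξ) := by
    ext x
    rw [Real.fourierInv_eq, lowFrequency, ← integral_indicator hB]
    congr 1
    ext ξ
    by_cases h : ξ ∈ Metric.ball (0 : RSpace d) r
    · rw [Set.indicator_of_mem h, Set.indicator_of_mem h]
    · rw [Set.indicator_of_notMem h, Set.indicator_of_notMem h, smul_zero]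
  rw [h]
  exact VectorFourier.fourierIntegral_continuous Real.continuous_fourierChar hL
    ((integrable_indicator_iff hB).2 (integrableOn_ball_fourier r u))

/-! ### Superlevel sets of the density and the exponential integral -/

lemma measurable_density {d N : ℕ} {s : ℝ} {Ω : Opens (RSpace d)} (u : Fin N → extSobolev s Ω) :
    Measurable (density u) := by
  unfold density
  exact Finset.measurable_sum _ fun n _ =>
    ((Lp.stronglyMeasurable (u n : L2 Ω)).measurable.norm.pow_const 2)

/-- Young's inequality with weights keeping the coefficient of the low part close to 1, at the cost
of 1/θ on the high part. -/
lemma norm_sq_le_div_add_div {z w : ℂ} {θ : ℝ} (hθ : 0 < θ) (hθ1 : θ < 1) :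
    ‖z‖ ^ 2 ≤ ‖w‖ ^ 2 / (1 - θ) + ‖z - w‖ ^ 2 / θ := by
  have hθ' : 0 < 1 - θ := by linarith
  have h1 : ‖z‖ ^ 2 ≤ (‖w‖ + ‖z - w‖) ^ 2 := by
    gcongr
    calc ‖z‖ = ‖w + (z - w)‖ := by rw [add_sub_cancel]
      _ ≤ _ := norm_add_le _ _
  refine h1.trans ?_
  rw [div_add_div _ _ hθ'.ne' hθ.ne', le_div_iff₀ (by positivity)]
  nlinarith [sq_nonneg (θ * ‖w‖ - (1 - θ) * ‖z - w‖)]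

/-- The measure of the superlevel sets of the density. -/
lemma measure_lt_density_le {d N : ℕ} (hd : 1 ≤ d) {s : ℝ} (hs : s = (d : ℝ) / 2)
    (Ω : Opens (RSpace d)) (hΩ : Bornology.IsBounded (Ω : Set (RSpace d)))
    (hV : 0 < (volume : Measure (RSpace d)).real Ω) (u : Fin N → extSobolev s Ω)
    (hu : ∀ a : Fin N → ℂ, ‖energyMap s Ω (∑ n, a n • u n)‖ ^ 2 ≤ ∑ n, ‖a n‖ ^ 2)
    {ε y : ℝ} (hε : 0 < ε) (hε1 : ε ≤ 1 / 4) (hy : 0 < y) :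
    volume.restrict (Ω : Set (RSpace d)) {x | y < semiclassicalConst d * density u x} ≤
      ENNReal.ofReal (256 * N * (volume : Measure (RSpace d)).real Ω /
        (ε ^ 3 * y * (Real.exp ((1 - 3 * ε / 4) * y) - 1))) := by
  set V := (volume : Measure (RSpace d)).real Ω with hVd
  set c := semiclassicalConst d with hcd
  have hc : 0 < c := semiclassicalConst_pos d
  set θ := ε / 4 with hθd
  have hθ : 0 < θ := by positivity
  have hθ1 : θ < 1 := by linarith
  have hθ' : 0 < 1 - θ := by linarith
  set Λ := c / (4 * V) with hΛd
  have hΛ : 0 < Λ := by positivity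
  set b := 1 - 3 * ε / 4 with hb
  have hb0 : 0 < b := by linarith
  have hE : 0 < Real.exp (b * y) - 1 := by
    have := Real.add_one_le_exp (b * y)
    have : 0 < b * y := by positivity
    linarith
  -- The value of (2πr)^d for which the logarithm in the low-frequency bound equals b y.
  set X := θ * Λ / (1 - θ) * (Real.exp (b * y) - 1) with hX
  have hX0 : 0 < X := by positivity
  obtain ⟨r, hr, hrX⟩ := exists_radius hd hX0
  have hlow : ∀ x, ∑ n, ‖lowFrequency r (u n : L2 Ω) x‖ ^ 2 ≤ (1 - θ) ^ 2 * y / c := by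
    intro x
    refine (sum_norm_lowFrequency_sq_le hs hθ hθ1 hΛ
      (mul_norm_sq_le_norm_energyMap_sq hd hs Ω hΩ hV) u hu r x).trans ?_
    have h1 : 1 + (1 - θ) * X / (θ * Λ) = Real.exp (b * y) := by
      rw [hX]; field_simp; ring
    rw [integral_ball_mixedWeight_inv hd hθ hθ1 hΛ hr, hrX, h1, Real.log_exp,
      div_le_div_iff₀ (by positivity) hc]
    -- Bernoulli's inequality, as b = 1 - 3θ. One factor 1 - θ is used by the weight, one by Young's
    -- inequality, and the third leaves the margin θy/c for the high part.
    have h2 : b ≤ (1 - θ) ^ 3 := by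
      have : b = 1 - 3 * θ := by rw [hb, hθd]; ring
      rw [this]
      nlinarith [mul_nonneg (sq_nonneg θ) (show 0 ≤ 3 - θ by linarith)]
    calc b * y * c ≤ (1 - θ) ^ 3 * y * c := by gcongr
      _ = _ := by ring
  set h : RSpace d → ℝ := fun x =>
    ∑ n, ‖((u n : L2 Ω) : RSpace d → ℂ) x - lowFrequency r (u n : L2 Ω) x‖ ^ 2 with hh
  have hsub : {x | y < c * density u x} ⊆
      {x | ENNReal.ofReal (θ ^ 2 * y / c) ≤ ENNReal.ofReal (h x)} := by
    intro x hx
    refine ENNReal.ofReal_le_ofReal ?_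
    have h1 : density u x ≤
        (∑ n, ‖lowFrequency r (u n : L2 Ω) x‖ ^ 2) / (1 - θ) + h x / θ := by
      rw [density, hh, Finset.sum_div, Finset.sum_div, ← Finset.sum_add_distrib]
      exact Finset.sum_le_sum fun n _ => norm_sq_le_div_add_div hθ hθ1
    have h2 : (∑ n, ‖lowFrequency r (u n : L2 Ω) x‖ ^ 2) / (1 - θ) ≤ (1 - θ) * y / c := by
      rw [div_le_iff₀ hθ']
      calc _ ≤ _ := hlow x
        _ = _ := by ring
    have h3 : y / c < density u x := (div_lt_iff₀' hc).2 hx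
    have h4 : θ * y / c ≤ h x / θ := by
      have : θ * y / c = y / c - (1 - θ) * y / c := by ring
      linarith
    rw [le_div_iff₀ hθ] at h4
    calc θ ^ 2 * y / c = θ * y / c * θ := by ring
      _ ≤ h x := h4
  have hm : ∀ n, Measurable fun x =>
      ‖((u n : L2 Ω) : RSpace d → ℂ) x - lowFrequency r (u n : L2 Ω) x‖ ^ 2 := fun n =>
    ((Lp.stronglyMeasurable (u n : L2 Ω)).measurable.sub
      (continuous_lowFrequency r (u n : L2 Ω)).measurable).norm.pow_const 2
  -- The contraction applied to the n-th unit vector.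
  have hE1 : ∀ n, ‖energyMap s Ω (u n)‖ ^ 2 ≤ 1 := fun n => by
    have h5 := hu (Pi.single n 1)
    rw [Finset.sum_eq_single n (by intros; simp [*]) (by simp),
      Finset.sum_eq_single n (by intros; simp [*]) (by simp)] at h5
    simpa using h5
  have hint : ∫⁻ x in (Ω : Set (RSpace d)), ENNReal.ofReal (h x) ≤ ENNReal.ofReal (N / X) := by
    have h6 : ∀ x, ENNReal.ofReal (h x) = ∑ n, ENNReal.ofReal
        (‖((u n : L2 Ω) : RSpace d → ℂ) x - lowFrequency r (u n : L2 Ω) x‖ ^ 2) :=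
      fun x => ENNReal.ofReal_sum_of_nonneg fun n _ => by positivity
    simp_rw [h6]
    rw [lintegral_finsetSum _ fun n _ => (hm n).ennreal_ofReal]
    calc _ ≤ ∑ _n : Fin N, ENNReal.ofReal (1 / X) := by
          refine Finset.sum_le_sum fun n _ =>
            (lintegral_sub_lowFrequency_sq_le hs hr (u n)).trans (ENNReal.ofReal_le_ofReal ?_)
          rw [hrX]
          gcongr
          exact hE1 n
      _ = _ := by
          rw [Finset.sum_const, Finset.card_univ, Fintype.card_fin, nsmul_eq_mul,
            ← ENNReal.ofReal_natCast, ← ENNReal.ofReal_mul (by positivity), mul_one_div]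
  have hpos : 0 < θ ^ 2 * y / c := by positivity
  refine (measure_mono hsub).trans ((meas_ge_le_lintegral_div
    (Finset.measurable_sum _ fun n _ => hm n).ennreal_ofReal.aemeasurable
    (by simpa using hpos) ENNReal.ofReal_ne_top).trans ?_)
  calc _ ≤ ENNReal.ofReal (N / X) / ENNReal.ofReal (θ ^ 2 * y / c) := by gcongr
    _ = ENNReal.ofReal (N / X / (θ ^ 2 * y / c)) := (ENNReal.ofReal_div_of_pos hpos).symm
    _ ≤ _ := ENNReal.ofReal_le_ofReal ?_
  -- Chebyshev's bound contains 4/θ³ = 256/ε³: the 4 and one 1/θ come from X, and 1/θ² from the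
  -- threshold.
  have h7 : (N : ℝ) / X / (θ ^ 2 * y / c) =
      (1 - θ) * (256 * N * V / (ε ^ 3 * y * (Real.exp (b * y) - 1))) := by
    rw [hX, hΛd, hθd]
    field_simp
    norm_num
    ring
  rw [h7]
  exact mul_le_of_le_one_left (by positivity) (by linarith)

/-- The layer-cake formula. The tails decay at rate 1 - 3ε/4 while the exponential grows at rate 1 -
ε, so the surplus ε/4 makes the integral converge. -/
lemma lintegral_exp_density_le {d N : ℕ} (hd : 1 ≤ d) (hN : 1 ≤ N) {s : ℝ} (hs : s = (d : ℝ) / 2)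
    (Ω : Opens (RSpace d)) (hΩ : Bornology.IsBounded (Ω : Set (RSpace d)))
    (hV : 0 < (volume : Measure (RSpace d)).real Ω) (u : Fin N → extSobolev s Ω)
    (hu : ∀ a : Fin N → ℂ, ‖energyMap s Ω (∑ n, a n • u n)‖ ^ 2 ≤ ∑ n, ‖a n‖ ^ 2)
    {ε : ℝ} (hε : 0 < ε) (hε1 : ε ≤ 1 / 4) :
    ∫⁻ x in (Ω : Set (RSpace d)),
        ENNReal.ofReal (Real.exp (semiclassicalConst d * (1 - ε) * density u x)) ≤
      ENNReal.ofReal ((volume : Measure (RSpace d)).real Ω *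
        (22 / ε ^ 4 * N * Real.exp (semiclassicalConst d))) := by
  set V := (volume : Measure (RSpace d)).real Ω with hVd
  set c := semiclassicalConst d with hcd
  have hc : Real.pi ≤ c := pi_le_semiclassicalConst hd
  set μ := (volume : Measure (RSpace d)).restrict (Ω : Set (RSpace d)) with hμ
  have hμV : μ Set.univ = ENNReal.ofReal V := by
    rw [hμ, Measure.restrict_apply_univ, hVd, Measure.real,
      ENNReal.ofReal_toReal hΩ.measure_lt_top.ne]
  have hN' : (1 : ℝ) ≤ N := by exact_mod_cast hN
  set b := 1 - 3 * ε / 4 with hb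
  have hε' : 0 < 1 - ε := by linarith
  -- Levels below 8 are estimated trivially. This avoids the singularity of the tail bound at y = 0
  -- and gains a factor 1/8 from 1/y.
  set f : RSpace d → ℝ := fun x => max (c * density u x - 8) 0 with hf
  set g : ℝ → ℝ := fun t => (1 - ε) * Real.exp ((1 - ε) * t) with hg
  have hG : ∀ y, ∫ t in (0 : ℝ)..y, g t = Real.exp ((1 - ε) * y) - 1 := by
    intro y
    rw [intervalIntegral.integral_eq_sub_of_hasDerivAt
      (f := fun t => Real.exp ((1 - ε) * t)) (fun t _ => ?_)
      (Continuous.intervalIntegrable (by fun_prop) _ _)]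
    · simp
    · simpa [hg, mul_comm] using ((hasDerivAt_id t).const_mul (1 - ε)).exp
  have hlc := lintegral_comp_eq_lintegral_meas_lt_mul μ (f := f) (g := g)
    (Filter.Eventually.of_forall fun x => le_max_right _ _)
    (((measurable_density u).const_mul c).sub_const 8 |>.max measurable_const).aemeasurable
    (fun t _ => Continuous.intervalIntegrable (by fun_prop) _ _)
    (Filter.Eventually.of_forall fun t => by positivity)
  have htail : ∀ t ∈ Set.Ioi (0 : ℝ), μ {x | t < f x} * ENNReal.ofReal (g t) ≤
      ENNReal.ofReal (64 * N * V / ε ^ 3 * Real.exp (-(8 * b)) * Real.exp (-(ε / 4) * t)) := by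
    intro t ht
    rw [Set.mem_Ioi] at ht
    have h1 : {x | t < f x} = {x | t + 8 < c * density u x} := by
      ext x
      simp only [hf, Set.mem_ofPred_eq, lt_max_iff, ht.not_gt, or_false, lt_sub_iff_add_lt]
    rw [h1]
    have h2 := measure_lt_density_le hd hs Ω hΩ hV u hu hε hε1 (show 0 < t + 8 by linarith)
    have h3 : 2 ≤ Real.exp (b * (t + 8)) := by
      have := Real.add_one_le_exp (b * (t + 8))
      nlinarith
    calc _ ≤ ENNReal.ofReal (256 * N * V / (ε ^ 3 * (t + 8) * (Real.exp (b * (t + 8)) - 1))) *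
          ENNReal.ofReal (g t) := by gcongr
      _ = ENNReal.ofReal (256 * N * V / (ε ^ 3 * (t + 8) * (Real.exp (b * (t + 8)) - 1)) *
          g t) := (ENNReal.ofReal_mul
            (div_nonneg (by positivity) (mul_nonneg (by positivity) (by linarith)))).symm
      _ ≤ _ := ENNReal.ofReal_le_ofReal ?_
    -- Here t + 8 ≥ 8, and e^z - 1 ≥ e^z/2 as e^z ≥ 2; hence 64 = 256 · 2/8.
    calc _ ≤ 256 * N * V / (ε ^ 3 * 8 * (Real.exp (b * (t + 8)) / 2)) *
          (1 * Real.exp ((1 - ε) * t)) := by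
          simp only [hg]
          gcongr
          · linarith
          · linarith
          · linarith
      _ = 64 * N * V / ε ^ 3 * (Real.exp (b * (t + 8)))⁻¹ * Real.exp ((1 - ε) * t) := by
          field_simp
          norm_num
      _ = _ := by
          rw [← Real.exp_neg, mul_assoc (64 * N * V / ε ^ 3), mul_assoc (64 * N * V / ε ^ 3),
            ← Real.exp_add, ← Real.exp_add]
          congr 2
          rw [hb]
          ring
  have hexp : ∫⁻ t in Set.Ioi (0 : ℝ), ENNReal.ofReal
      (64 * N * V / ε ^ 3 * Real.exp (-(8 * b)) * Real.exp (-(ε / 4) * t)) =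
      ENNReal.ofReal (256 * N * V / ε ^ 4 * Real.exp (-(8 * b))) := by
    rw [← ofReal_integral_eq_lintegral_ofReal
      ((integrableOn_exp_mul_Ioi (by linarith) 0).const_mul _)
      (Filter.Eventually.of_forall fun t => by positivity),
      integral_const_mul, integral_exp_mul_Ioi (by linarith)]
    congr 1
    simp only [mul_zero, Real.exp_zero]
    field_simp
    norm_num
  have hpt : ∀ x, ENNReal.ofReal (Real.exp (c * (1 - ε) * density u x)) ≤
      ENNReal.ofReal (Real.exp (8 * (1 - ε))) *
        (1 + ENNReal.ofReal (∫ t in (0 : ℝ)..f x, g t)) := by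
    intro x
    have h4 : 0 ≤ f x := le_max_right _ _
    have h5 : c * density u x ≤ 8 + f x := by
      have : c * density u x - 8 ≤ f x := le_max_left _ _
      linarith
    have h6 : 1 ≤ Real.exp ((1 - ε) * f x) := Real.one_le_exp (by positivity)
    rw [hG, ← ENNReal.ofReal_one, ← ENNReal.ofReal_add zero_le_one (by linarith),
      add_sub_cancel, ← ENNReal.ofReal_mul (by positivity), ← Real.exp_add]
    refine ENNReal.ofReal_le_ofReal (Real.exp_le_exp.2 ?_)
    calc c * (1 - ε) * density u x = (1 - ε) * (c * density u x) := by ring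
      _ ≤ (1 - ε) * (8 + f x) := by gcongr
      _ = _ := by ring
  calc _ ≤ ∫⁻ x, ENNReal.ofReal (Real.exp (8 * (1 - ε))) *
        (1 + ENNReal.ofReal (∫ t in (0 : ℝ)..f x, g t)) ∂μ := lintegral_mono hpt
    _ = ENNReal.ofReal (Real.exp (8 * (1 - ε))) * (ENNReal.ofReal V +
        ∫⁻ t in Set.Ioi 0, μ {x | t < f x} * ENNReal.ofReal (g t)) := by
        rw [lintegral_const_mul' _ _ ENNReal.ofReal_ne_top, lintegral_add_left measurable_const,
          lintegral_one, hμV, hlc]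
    _ ≤ ENNReal.ofReal (Real.exp (8 * (1 - ε))) * (ENNReal.ofReal V +
        ENNReal.ofReal (256 * N * V / ε ^ 4 * Real.exp (-(8 * b)))) := by
        gcongr
        rw [← hexp]
        exact setLIntegral_mono (by fun_prop) htail
    _ = ENNReal.ofReal (Real.exp (8 * (1 - ε)) *
        (V + 256 * N * V / ε ^ 4 * Real.exp (-(8 * b)))) := by
        rw [← ENNReal.ofReal_add hV.le (by positivity), ← ENNReal.ofReal_mul (by positivity)]
    _ ≤ _ := ENNReal.ofReal_le_ofReal ?_
  -- With M = N/ε^4 ≥ 256, the levels below 8 cost at most e^8 ≤ 26 M and the tail at most 256 M.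
  -- The sum 282 M is below 22 · 13 M, and 13 ≤ e^3 ≤ e^c.
  have hε4 : 256 ≤ N / ε ^ 4 := by
    rw [le_div_iff₀ (by positivity)]
    have : ε ^ 4 ≤ (1 / 4) ^ 4 := by gcongr
    linarith
  have h8 : Real.exp (8 * (1 - ε)) ≤ 26 * (N / ε ^ 4) := by
    have h9 : Real.exp (8 * (1 - ε)) ≤ Real.exp 1 ^ 8 := by
      rw [← Real.exp_nat_mul]
      exact Real.exp_le_exp.2 (by push_cast; linarith)
    have h10 : Real.exp 1 ^ 8 ≤ 2.72 ^ 8 := by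
      gcongr
      linarith [Real.exp_one_lt_d9]
    have h10' : (2.72 : ℝ) ^ 8 ≤ 26 * 256 := by norm_num
    linarith
  have h11 : Real.exp (8 * (1 - ε)) * Real.exp (-(8 * b)) ≤ 1 := by
    rw [← Real.exp_add, Real.exp_le_one_iff]
    linarith
  have h12 : 13 ≤ Real.exp c := by
    have h13 : Real.exp 1 ^ 3 ≤ Real.exp c := by
      rw [← Real.exp_nat_mul]
      exact Real.exp_le_exp.2 (by push_cast; linarith [Real.pi_gt_three])
    have h14 : (2.71 : ℝ) ^ 3 ≤ Real.exp 1 ^ 3 := by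
      gcongr
      linarith [Real.exp_one_gt_d9]
    have h14' : (13 : ℝ) ≤ 2.71 ^ 3 := by norm_num
    linarith
  set M := (N : ℝ) / ε ^ 4 with hM
  have hM0 : 0 ≤ M := by positivity
  calc Real.exp (8 * (1 - ε)) * (V + 256 * N * V / ε ^ 4 * Real.exp (-(8 * b)))
      = V * (Real.exp (8 * (1 - ε)) +
          256 * M * (Real.exp (8 * (1 - ε)) * Real.exp (-(8 * b)))) := by rw [hM]; ring
    _ ≤ V * (26 * M + 256 * M * 1) := by gcongr
    _ ≤ V * (22 * M * 13) := by gcongr; linarith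
    _ ≤ V * (22 * M * Real.exp c) := by gcongr
    _ = _ := by rw [hM]; ring


/-! ### Jensen's inequality and the logarithmic regime -/

lemma exp_mul_le_affine {p x : ℝ} (hp : 0 ≤ p) (hp1 : p ≤ 1) :
    Real.exp (p * x) ≤ 1 - p + p * Real.exp x := by
  have h := convexOn_exp.2 (Set.mem_univ 0) (Set.mem_univ x) (sub_nonneg.2 hp1) hp (by ring)
  simpa using h

/-- Jensen's inequality for exponentials and powers at most one. -/
lemma lintegral_exp_mul_le {X : Type*} [MeasurableSpace X] {μ : Measure X} {E : X → ℝ}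
    {V m p : ℝ} (hV : 0 ≤ V) (hμ : μ Set.univ = ENNReal.ofReal V) (hp : 0 ≤ p) (hp1 : p ≤ 1)
    (hE : ∫⁻ x, ENNReal.ofReal (Real.exp (E x)) ∂μ ≤ ENNReal.ofReal (V * Real.exp m)) :
    ∫⁻ x, ENNReal.ofReal (Real.exp (p * E x)) ∂μ ≤ ENNReal.ofReal (V * Real.exp (p * m)) := by
  have h1 : 0 ≤ Real.exp (p * m) * (1 - p) := mul_nonneg (by positivity) (by linarith)
  have h2 : 0 ≤ Real.exp (p * m) * p * Real.exp (-m) := by positivity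
  -- Integrate the affine bound at E - m, multiplied by e^{pm}. Centring at m makes the two terms
  -- add up to exactly V e^{pm}.
  calc _ ≤ ∫⁻ x, (ENNReal.ofReal (Real.exp (p * m) * (1 - p)) +
        ENNReal.ofReal (Real.exp (p * m) * p * Real.exp (-m)) *
          ENNReal.ofReal (Real.exp (E x))) ∂μ := by
        refine lintegral_mono fun x => ?_
        rw [← ENNReal.ofReal_mul h2, ← ENNReal.ofReal_add h1 (by positivity)]
        refine ENNReal.ofReal_le_ofReal ?_
        have h3 := mul_le_mul_of_nonneg_left (exp_mul_le_affine (x := E x - m) hp hp1)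
          (Real.exp_pos (p * m)).le
        rw [← Real.exp_add, show p * m + p * (E x - m) = p * E x by ring, sub_eq_add_neg (E x),
          Real.exp_add (E x)] at h3
        refine h3.trans_eq ?_
        ring
    _ = ENNReal.ofReal (Real.exp (p * m) * (1 - p)) * ENNReal.ofReal V +
        ENNReal.ofReal (Real.exp (p * m) * p * Real.exp (-m)) *
          ∫⁻ x, ENNReal.ofReal (Real.exp (E x)) ∂μ := by
        rw [lintegral_add_left measurable_const, lintegral_const, hμ,
          lintegral_const_mul' _ _ ENNReal.ofReal_ne_top]
    _ ≤ ENNReal.ofReal (Real.exp (p * m) * (1 - p)) * ENNReal.ofReal V +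
        ENNReal.ofReal (Real.exp (p * m) * p * Real.exp (-m)) *
          ENNReal.ofReal (V * Real.exp m) := by gcongr
    _ = _ := by
        rw [← ENNReal.ofReal_mul h1, ← ENNReal.ofReal_mul h2,
          ← ENNReal.ofReal_add (by positivity) (by positivity)]
        congr 1
        rw [Real.exp_neg]
        field_simp
        ring

lemma log_twentyTwo_le : Real.log 22 ≤ 3.1 := by
  rw [Real.log_le_iff_le_exp (by norm_num), show (3.1 : ℝ) = (3 : ℕ) * 1 + 0.1 by norm_num,
    Real.exp_add, Real.exp_nat_mul]
  have h1 : (2.718 : ℝ) ^ 3 ≤ Real.exp 1 ^ 3 := by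
    gcongr
    linarith [Real.exp_one_gt_d9]
  have h2 : (1.1 : ℝ) ≤ Real.exp 0.1 := by
    have := Real.add_one_le_exp (0.1 : ℝ)
    linarith
  calc (22 : ℝ) ≤ 2.718 ^ 3 * 1.1 := by norm_num
    _ ≤ _ := by gcongr

/-- Since c ≥ π and ln L ≥ ln 4, the lower-order terms satisfy ln 22 + 1 + 4 ln L + c ≤ 3c ln L.
After cross-multiplication the slack is c ln L · (L - 4), so L ≥ 4 suffices. -/
lemma exponent_bound {c L : ℝ} (hc : Real.pi ≤ c) (hL : 4 ≤ L) :
    (Real.log 22 + 4 * Real.log L + L + c) / (L - 1) ≤ 1 + 4 * c * (Real.log L / L) := by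
  have h1 := log_twentyTwo_le
  have hl : 1.386 ≤ Real.log L := by
    have h2 : Real.log 4 = 2 * Real.log 2 := by
      rw [show (4 : ℝ) = 2 ^ 2 by norm_num, Real.log_pow]
      norm_num
    have h3 : Real.log 4 ≤ Real.log L := Real.log_le_log (by norm_num) hL
    linarith [Real.log_two_gt_d9]
  set l := Real.log L
  have hc' : 3.14 ≤ c := by linarith [Real.pi_gt_d2]
  have hL0 : 0 < L - 1 := by linarith
  have h4 : Real.log 22 + 1 + 4 * l + c ≤ 3 * c * l := by
    nlinarith [mul_nonneg (sub_nonneg.2 hc') (sub_nonneg.2 hl)]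
  have h5 : 0 ≤ c * l := by nlinarith
  have h6 : 1 + 4 * c * (l / L) = (L + 4 * c * l) / L := by
    field_simp
  rw [h6, div_le_div_iff₀ hL0 (by linarith)]
  nlinarith [mul_le_mul_of_nonneg_left h4 (show (0 : ℝ) ≤ L by linarith),
    mul_nonneg h5 (show 0 ≤ L - 4 by linarith)]

lemma lintegral_exp_density_div_log_le {d N : ℕ} (hd : 1 ≤ d) {s : ℝ} (hs : s = (d : ℝ) / 2)
    (Ω : Opens (RSpace d)) (hΩ : Bornology.IsBounded (Ω : Set (RSpace d)))
    (hV : 0 < (volume : Measure (RSpace d)).real Ω) (u : Fin N → extSobolev s Ω)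
    (hu : ∀ a : Fin N → ℂ, ‖energyMap s Ω (∑ n, a n • u n)‖ ^ 2 ≤ ∑ n, ‖a n‖ ^ 2)
    {α : ℝ} (hα : 0 < α) (hN : Real.exp 4 ≤ N)
    (hNα : Real.exp (α / semiclassicalConst d + 1) ≤ N) :
    ∫⁻ x in (Ω : Set (RSpace d)),
        ENNReal.ofReal (Real.exp (α * (density u x / Real.log N))) ≤
      ENNReal.ofReal ((volume : Measure (RSpace d)).real Ω *
        Real.exp (α / semiclassicalConst d * (1 + 4 * semiclassicalConst d *
          (Real.log (Real.log N) / Real.log N)))) := by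
  have hN0 : (0 : ℝ) < N := (Real.exp_pos 4).trans_le hN
  have hN1 : 1 ≤ N := by exact_mod_cast hN0
  set c := semiclassicalConst d with hcd
  have hc : Real.pi ≤ c := pi_le_semiclassicalConst hd
  have hc0 : 0 < c := semiclassicalConst_pos d
  set L := Real.log N with hLd
  have hL : 4 ≤ L := (Real.le_log_iff_exp_le hN0).2 hN
  have hLα : α / c + 1 ≤ L := (Real.le_log_iff_exp_le hN0).2 hNα
  have hL1 : 0 < L - 1 := by linarith
  -- Chosen so that p c (1 - 1/L) = α/L; the lower bound on N in terms of α is exactly p ≤ 1.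
  set p := α / c / (L - 1) with hp
  have hp0 : 0 ≤ p := by positivity
  have hp1 : p ≤ 1 := by rw [hp, div_le_one hL1]; linarith
  set m := Real.log 22 + 4 * Real.log L + L + c with hm
  have hexp : Real.exp m = 22 / (1 / L) ^ 4 * N * Real.exp c := by
    rw [hm, Real.exp_add, Real.exp_add, Real.exp_add, Real.exp_log (by norm_num), hLd,
      Real.exp_log hN0, ← hLd, show (4 : ℝ) * Real.log L = (4 : ℕ) * Real.log L by norm_num,
      Real.exp_nat_mul, Real.exp_log (by linarith)]
    field_simp
  -- The choice ε = 1/L is admissible because N ≥ e^4, and it turns 1/ε^4 into L^4, the source of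
  -- the ln ln N correction.
  have h1 := lintegral_exp_density_le hd hN1 hs Ω hΩ hV u hu (ε := 1 / L) (by positivity)
    (one_div_le_one_div_of_le (by norm_num) hL)
  rw [← hexp] at h1
  have h2 := lintegral_exp_mul_le hV.le (by
    rw [Measure.restrict_apply_univ, Measure.real,
      ENNReal.ofReal_toReal hΩ.measure_lt_top.ne]) hp0 hp1 h1
  have h3 : ∀ x, p * (c * (1 - 1 / L) * density u x) = α * (density u x / L) := by
    intro x
    rw [hp]
    field_simp
  simp_rw [← hcd, h3] at h2
  refine h2.trans (ENNReal.ofReal_le_ofReal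
    (mul_le_mul_of_nonneg_left (Real.exp_le_exp.2 ?_) hV.le))
  calc p * m = α / c * (m / (L - 1)) := by rw [hp]; ring
    _ ≤ _ := by
      gcongr
      exact exponent_bound hc hL

theorem theorem3p1 (d : ℕ) (hd : 1 ≤ d) (s : ℝ) (hs : s = (d : ℝ) / 2)
    (Ω : Opens (RSpace d)) (hΩ : Bornology.IsBounded (Ω : Set (RSpace d)))
    (H0s : Submodule ℂ (extSobolev s Ω)) (hH0s : H0s = zeroSobolev s Ω ∨ H0s = ⊤)
    (N : ℕ) (u : Fin N → extSobolev s Ω) (hu : ∀ n, u n ∈ H0s)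
    (hop : ∑ n, InnerProductSpace.rankOne ℂ (u n : L2 Ω) (u n : L2 Ω) ≤
      fracLaplacianInv s Ω H0s) :
    (1 ≤ N → ∀ ε : ℝ, 0 < ε → ε ≤ 1 / 4 →
      (volume (Ω : Set (RSpace d)))⁻¹ *
          ∫⁻ x in (Ω : Set (RSpace d)), ENNReal.ofReal
            (Real.exp ((2 * Real.pi) ^ d / unitBallVolume d * (1 - ε) * density u x)) ≤
        ENNReal.ofReal
          (22 / ε ^ 4 * N * Real.exp ((2 * Real.pi) ^ d / unitBallVolume d))) ∧
    (∀ α : ℝ, 0 < α →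
      max (Real.exp 4) (Real.exp (α * unitBallVolume d / (2 * Real.pi) ^ d + 1)) ≤ (N : ℝ) →
      (volume (Ω : Set (RSpace d)))⁻¹ *
          ∫⁻ x in (Ω : Set (RSpace d)), ENNReal.ofReal
            (Real.exp (α * (density u x / Real.log N))) ≤
        ENNReal.ofReal
          (Real.exp (α * unitBallVolume d / (2 * Real.pi) ^ d *
            (1 + 4 * (2 * Real.pi) ^ d / unitBallVolume d *
              (Real.log (Real.log N) / Real.log N))))) := by
  -- If |Ω| = 0, the inverse volume is ∞ but the integral is 0, and ∞ · 0 = 0 in `ℝ≥0∞`.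
  rcases eq_or_ne (volume (Ω : Set (RSpace d))) 0 with h0 | h0
  · have hz : (volume : Measure (RSpace d)).restrict (Ω : Set (RSpace d)) = 0 :=
      Measure.restrict_eq_zero.2 h0
    simp [hz]
  have hfin : volume (Ω : Set (RSpace d)) ≠ ⊤ := hΩ.measure_lt_top.ne
  have hV : 0 < (volume : Measure (RSpace d)).real Ω := ENNReal.toReal_pos h0 hfin
  have hs0 : 0 < s := by
    rw [hs]
    positivity
  have hdual := norm_energyMap_sum_sq_le hd hs0 Ω hΩ H0s
    (isClosed_map_energyMap hd hs0 Ω hΩ H0s hH0s) u hu hop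
  have hmean : ∀ {I : ℝ≥0∞} {B : ℝ}, I ≤ ENNReal.ofReal
      ((volume : Measure (RSpace d)).real Ω * B) →
      (volume (Ω : Set (RSpace d)))⁻¹ * I ≤ ENNReal.ofReal B := by
    intro I B h
    rwa [ENNReal.ofReal_mul hV.le, Measure.real, ENNReal.ofReal_toReal hfin,
      ← ENNReal.inv_mul_le_iff h0 hfin] at h
  refine ⟨fun hN ε hε hε1 => hmean (lintegral_exp_density_le hd hN hs Ω hΩ hV u hdual hε hε1),
    fun α hα hN => ?_⟩
  have h1 : α * unitBallVolume d / (2 * Real.pi) ^ d = α / semiclassicalConst d := by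
    rw [semiclassicalConst, div_div_eq_mul_div]
  have h2 : 4 * (2 * Real.pi) ^ d / unitBallVolume d = 4 * semiclassicalConst d := by
    rw [semiclassicalConst, mul_div_assoc]
  rw [h1] at hN ⊢
  rw [h2]
  exact hmean (lintegral_exp_density_div_log_le hd hs Ω hΩ hV u hdual hα
    ((le_max_left _ _).trans hN) ((le_max_right _ _).trans hN))

end
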